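/- **Definitions.** A promise problem $\mathcal P=(\mathcal P^{\mathrm{yes}},\mathcal P^{\mathrm{no}})$ for quantum state testing consists of two disjoint sets of $n$-qubit density operators, for some $n\ge 0$. The *sample complexity* $\mathsf S(\mathcal P)\in\{0,1,2,\dots\}\cup\{\infty\}$ is the least $s$ for which there is a two-outcome measurement $\{M, I-M\}$ (with $0\le M\le I$) of $s$ copies of an $n$-qubit state such that $\operatorname{tr}(M\rho^{\otimes s})\ge 2/3$ for all $\rho\in\mathcal P^{\mathrm{yes}}$ and $\operatorname{tr}(M\rho^{\otimes s})\le 1/3$ for all $\rho\in\mathcal P^{\mathrm{no}}$ ($\infty$ if there is no such $s$). A unitary $U$ on $a+n$ qubits is a *block-encoding* of an $n$-qubit operator $A$ if $\langle 0|^{\otimes a}\,U\,|0\rangle^{\otimes a}=A$. A *query algorithm* with $Q$ queries is a circuit $\mathcal A^U=G_QU_Q\cdots G_1U_1G_0$ in which each $U_j$ is $U$, $U^\dagger$, controlled-$U$ or controlled-$U^\dagger$, and the $G_j$ are unitaries, independent of $U$, on the oracle's qubits together with finitely many further qubits; it accepts $U$ with probability $\|(|0\rangle\langle 0|\otimes I)\,\mathcal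 A^U|0\rangle\|^2$, where the projector acts on the first qubit. The *query complexity* $\mathsf Q_\diamond(\mathcal P)\in\{0,1,2,\dots\}\cup\{\infty\}$ is the least $Q$ such that for every $a\ge 0$ there is a query algorithm with $Q$ queries that, for every $(a+n)$-qubit block-encoding $U$ of $\tfrac12\rho$, accepts $U$ with probability at least $2/3$ if $\rho\in\mathcal P^{\mathrm{yes}}$ and at most $1/3$ if $\rho\in\mathcal P^{\mathrm{no}}$ ($\infty$ if there is no such $Q$). **Theorem (quantum sample-to-query lifting).** For every promise problem $\mathcal P$ for quantum state testing, $$\mathsf Q_\diamond(\mathcal P)=\Omega\!\left(\frac{\sqrt{\mathsf S(\mathcal P)}}{\log \mathsf S(\mathcal P)}\right).$$ That is, there is a universal constant $c>0$ such that for every $n$ and every promise problem $\mathcal P$ for $n$-qubit states: if $2\le\mathsf S(\mathcal P)<\infty$, then $\mathsf Q_\diamond(\mathcal P)\ge c\,\sqrt{\mathsf S(\mathcal P)}/\log \mathsf S(\mathcal P)$; and if $\mathsf S(\mathcal P)=\infty$, then $\mathsf Q_\diamond(\mathcal P)=\infty$. -/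

import Mathlib

open scoped ComplexOrder Kronecker

namespace QuantumLifting

/-- Labels of the computational basis of `k` qubits; the label of `|0⟩^{⊗k}` is `0`. -/
abbrev Qubits (k : ℕ) : Type := Fin k → Fin 2

/-- Square complex matrices, that is, operators in the computational basis `ι`. -/
abbrev Op (ι : Type) : Type := Matrix ι ι ℂ

/-- Density operators of `n` qubits. -/
structure DensityOperator (n : ℕ) where
  /-- The underlying matrix. -/
  mat : Op (Qubits n)
  posSemidef : mat.PosSemidef
  trace_eq_one : mat.trace = 1

/-- A promise problem for testing `n`-qubit states: disjoint sets of *yes* and *no* instances. -/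
structure StateTestingProblem (n : ℕ) where
  /-- The yes instances. -/
  yes : Set (DensityOperator n)
  /-- The no instances. -/
  no : Set (DensityOperator n)
  disjoint : Disjoint yes no

/-! ### Sample complexity -/

/-- The state `ρ^{⊗s}` of `s` independent samples of `ρ`. -/
def copies {n : ℕ} (ρ : DensityOperator n) (s : ℕ) : Op (Fin s → Qubits n) :=
  Matrix.of fun x y => ∏ k, ρ.mat (x k) (y k)

/-- A tester using `s` samples of an `n`-qubit state: a two-outcome measurement (POVM)
`{accept, 1 - accept}` of the `s` samples jointly. -/
structure SampleTester (n s : ℕ) where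
  /-- The POVM element of the outcome "accept". -/
  accept : Op (Fin s → Qubits n)
  accept_posSemidef : accept.PosSemidef
  reject_posSemidef : (1 - accept).PosSemidef

/-- The probability that the tester accepts when it is given samples of `ρ`. -/
noncomputable def SampleTester.acceptProb {n s : ℕ} (T : SampleTester n s)
    (ρ : DensityOperator n) : ℝ :=
  (T.accept * copies ρ s).trace.re

/-- The tester solves `P` with success probability at least `2/3`. -/
def SampleTester.Solves {n s : ℕ} (T : SampleTester n s) (P : StateTestingProblem n) : Prop :=
  (∀ ρ ∈ P.yes, 2 / 3 ≤ T.acceptProb ρ) ∧ (∀ ρ ∈ P.no, T.acceptProb ρ ≤ 1 / 3)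

/-- The sample complexity `S(P)`: the least number of samples with which `P` can be solved
(`⊤` if no number of samples suffices). -/
noncomputable def sampleComplexity {n : ℕ} (P : StateTestingProblem n) : ℕ∞ :=
  ⨅ (s : ℕ) (_ : ∃ T : SampleTester n s, T.Solves P), (s : ℕ∞)

/-! ### Query complexity -/

/-- The unitary `U` on `a + n` qubits is a block-encoding of the `n`-qubit operator `A`:
`⟨0|^{⊗a} U |0⟩^{⊗a} = A`. -/
def IsBlockEncoding {a n : ℕ} (U : Matrix.unitaryGroup (Qubits a × Qubits n) ℂ)
    (A : Op (Qubits n)) : Prop :=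
  (Matrix.of fun x y => (U : Op (Qubits a × Qubits n)) (0, x) (0, y)) = A

/-- The four kinds of queries to `U`: `U`, `U†`, controlled-`U`, controlled-`U†`. -/
inductive QueryKind
  | plain
  | inverse
  | controlled
  | controlledInverse

/-- The register of a query algorithm: one qubit (serving as the control of controlled queries
and as the output qubit), `w` further work qubits, and the `a + n` qubits that the oracle acts on.
Fixing these positions is no restriction, since the gates between queries are arbitrary unitaries
on the whole register and may permute its qubits. -/
abbrev Register (w a n : ℕ) : Type := Fin 2 × (Qubits w × (Qubits a × Qubits n))

/-- The operator on the register that a query applies. -/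
def queryOp {a n : ℕ} (w : ℕ) (U : Matrix.unitaryGroup (Qubits a × Qubits n) ℂ) :
    QueryKind → Op (Register w a n)
  | .plain => (1 : Op (Fin 2)) ⊗ₖ ((1 : Op (Qubits w)) ⊗ₖ (U : Op (Qubits a × Qubits n)))
  | .inverse =>
      (1 : Op (Fin 2)) ⊗ₖ ((1 : Op (Qubits w)) ⊗ₖ (U : Op (Qubits a × Qubits n)).conjTranspose)
  | .controlled =>
      Matrix.single 0 0 1 ⊗ₖ (1 : Op (Qubits w × (Qubits a × Qubits n))) +
        Matrix.single 1 1 1 ⊗ₖ ((1 : Op (Qubits w)) ⊗ₖ (U : Op (Qubits a × Qubits n)))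
  | .controlledInverse =>
      Matrix.single 0 0 1 ⊗ₖ (1 : Op (Qubits w × (Qubits a × Qubits n))) +
        Matrix.single 1 1 1 ⊗ₖ
          ((1 : Op (Qubits w)) ⊗ₖ (U : Op (Qubits a × Qubits n)).conjTranspose)

/-- A query algorithm `G_Q U_Q ⋯ G_1 U_1 G_0` for oracles on `a + n` qubits: the unitary `G_0`,
and the list of pairs (kind of the query `U_j`, unitary `G_j`) for `j = 1, …, Q`. -/
structure QueryAlgorithm (a n : ℕ) where
  /-- The number of additional work qubits. -/
  work : ℕ
  /-- The unitary `G_0`. -/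
  init : Matrix.unitaryGroup (Register work a n) ℂ
  /-- The queries, in order, each followed by a unitary independent of the oracle. -/
  steps : List (QueryKind × Matrix.unitaryGroup (Register work a n) ℂ)

/-- The number of queries of the algorithm. -/
def QueryAlgorithm.queries {a n : ℕ} (A : QueryAlgorithm a n) : ℕ := A.steps.length

/-- The operator `A^U = G_Q U_Q ⋯ G_1 U_1 G_0`. -/
def QueryAlgorithm.circuit {a n : ℕ} (A : QueryAlgorithm a n)
    (U : Matrix.unitaryGroup (Qubits a × Qubits n) ℂ) : Op (Register A.work a n) :=
  A.steps.foldl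
    (fun M s => (s.2 : Op (Register A.work a n)) * queryOp A.work U s.1 * M)
    (A.init : Op (Register A.work a n))

/-- The probability `‖(|0⟩⟨0| ⊗ I) A^U |0⟩‖²` that the algorithm accepts `U`, i.e. that measuring
the first qubit of `A^U |0⟩` gives `0`. -/
noncomputable def QueryAlgorithm.acceptProb {a n : ℕ} (A : QueryAlgorithm a n)
    (U : Matrix.unitaryGroup (Qubits a × Qubits n) ℂ) : ℝ :=
  ∑ x : Qubits A.work × (Qubits a × Qubits n), ‖A.circuit U (0, x) 0‖ ^ 2

/-- The algorithm solves, with success probability at least `2/3`, the unitary property testing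
problem whose instances are the `(a + n)`-qubit block-encodings of `ρ / 2`, for `ρ` an instance
of `P`. -/
def QueryAlgorithm.Solves {a n : ℕ} (A : QueryAlgorithm a n) (P : StateTestingProblem n) : Prop :=
  ∀ (ρ : DensityOperator n) (U : Matrix.unitaryGroup (Qubits a × Qubits n) ℂ),
    IsBlockEncoding U ((1 / 2 : ℂ) • ρ.mat) →
      (ρ ∈ P.yes → 2 / 3 ≤ A.acceptProb U) ∧ (ρ ∈ P.no → A.acceptProb U ≤ 1 / 3)

/-- `P` can be solved with `q` queries to a block-encoding of `ρ / 2`, whatever the number `a` of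
ancilla qubits of the block-encoding (the circuit may depend on `a`, the size of the oracle). -/
def QuerySolvable {n : ℕ} (P : StateTestingProblem n) (q : ℕ) : Prop :=
  ∀ a : ℕ, ∃ A : QueryAlgorithm a n, A.queries = q ∧ A.Solves P

/-- The query complexity `Q_⋄(P)`: the least number of queries to a block-encoding of `ρ / 2` with
which `P` can be solved (`⊤` if no number of queries suffices). -/
noncomputable def queryComplexity {n : ℕ} (P : StateTestingProblem n) : ℕ∞ :=
  ⨅ (q : ℕ) (_ : QuerySolvable P q), (q : ℕ∞)

end QuantumLifting

namespace QuantumLifting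

/-! The core is that `q` queries to a block-encoding of `ρ / 2` can be replaced by `3 * (480 * q) ^
2` samples of `ρ`. This even gives a bound of order `√S`; the logarithm in the statement is only
used through `log s ≥ log 2`.

Let `Ψ Ψ† = ρ`, so that `|Ψ⟩` purifies `ρ`, and let `R` be the reflection about `φ = (|⊥⟩ - |Ψ⟩) /
√2`. Then `R |⊥⟩ = |Ψ⟩`, so for a fixed gate `C` (a rotation with corner entry `1 / 2` and a swap of
the system) the product `R C R` is a block-encoding of `ρ / 2` (`isBlockEncoding_oracleOp`). Since
`R² = 1`, every kind of query to it is a fixed gate between two copies of `R` (`queryOp_oracleOp`).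

A reflection about `φ` can be imitated with `k` copies of `φ`: reflect `v ⊗ φ^{⊗k}` about the
cyclically invariant vectors instead. The error is at most `2 / √(k + 1)` for unit `v`, and the
copies are left nearly intact, so the same ones serve all queries (`l2norm_cyclicCircuit_sub_le`).
Thus the algorithm becomes a measurement of `φ^{⊗k}`, with `k` of order `q²`
(`exists_povm_of_queryAlgorithm`).

Copies of a purification cannot be made from copies of `ρ`, but only an average is needed: put `Ψ =
√ρ V` with one Haar random `V` shared by all copies. The averaged state is `D T D`, where `D = (1 ⊕
√ρ ⊗ 1)^{⊗k}` and `T` is its value for `√ρ = 1`. As `T` commutes with `D`, it equals `√T (1 ⊕ ρ ⊗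
1)^{⊗k} √T`, which is the image of `ρ^{⊗k}` under a completely positive map not depending on `ρ`
(`exists_sampleTester`). Every `V` yields a legitimate block-encoding, so the guarantees of the
algorithm survive averaging; a majority vote of three runs absorbs the simulation error. -/

/-! ### Tensor products of matrices -/

section TensorProd

variable {α β γ J : Type} {k : ℕ}

/-- The tensor product `M 0 ⊗ ⋯ ⊗ M (k - 1)`. -/
def tensorProd (M : Fin k → Matrix α β ℂ) : Matrix (Fin k → α) (Fin k → β) ℂ :=
  Matrix.of fun x y => ∏ i, M i (x i) (y i)

theorem tensorProd_apply (M : Fin k → Matrix α β ℂ) (x : Fin k → α) (y : Fin k → β) :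
    tensorProd M x y = ∏ i, M i (x i) (y i) := rfl

theorem tensorProd_mul [Fintype β] (M : Fin k → Matrix α β ℂ) (N : Fin k → Matrix β γ ℂ) :
    tensorProd M * tensorProd N = tensorProd fun i => M i * N i := by
  classical
  ext x y
  simp only [Matrix.mul_apply, tensorProd_apply, ← Finset.prod_mul_distrib]
  rw [Finset.prod_univ_sum, Fintype.piFinset_univ]

theorem tensorProd_conjTranspose (M : Fin k → Matrix α β ℂ) :
    (tensorProd M).conjTranspose = tensorProd fun i => (M i).conjTranspose := by
  ext x y
  simp [tensorProd_apply]

theorem tensorProd_one [DecidableEq α] : tensorProd (fun _ : Fin k => (1 : Op α)) = 1 := by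
  ext x y
  simp only [tensorProd_apply, Matrix.one_apply, Finset.prod_ite_zero, Finset.prod_const_one,
    Finset.mem_univ, true_imp_iff, funext_iff]

theorem sum_tensorProd [Fintype J] (M : J → Matrix α β ℂ) :
    ∑ j : Fin k → J, tensorProd (fun i => M (j i)) = tensorProd fun _ => ∑ j, M j := by
  classical
  ext x y
  simp only [Matrix.sum_apply, tensorProd_apply]
  rw [Finset.prod_univ_sum, Fintype.piFinset_univ]

/-- The tensor power `φ^{⊗k}` of a vector. -/
def tensorVec (k : ℕ) (φ : α → ℂ) : (Fin k → α) → ℂ := fun x => ∏ i, φ (x i)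

theorem tensorProd_vecMulVec (φ : α → ℂ) :
    tensorProd (fun _ : Fin k => Matrix.vecMulVec φ (star φ)) =
      Matrix.vecMulVec (tensorVec k φ) (star (tensorVec k φ)) := by
  ext x y
  simp [tensorProd_apply, Matrix.vecMulVec_apply, tensorVec, Finset.prod_mul_distrib]

end TensorProd

/-! ### Averages over the unitary group -/

theorem isClosed_unitaryGroup {A : Type} [Fintype A] [DecidableEq A] :
    IsClosed (Matrix.unitaryGroup A ℂ : Set (Op A)) := isClosed_unitary

section Haar

attribute [local instance] Matrix.normedAddCommGroup Matrix.normedSpace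

variable {A ι : Type} [Fintype A] [DecidableEq A] [Fintype ι]

/-- Compactness makes Haar measure a probability measure and every continuous function integrable.
-/
instance compactSpace_unitaryGroup : CompactSpace (Matrix.unitaryGroup A ℂ) := by
  have : ProperSpace (Matrix A A ℂ) := FiniteDimensional.proper ℂ _
  refine (isCompact_iff_compactSpace (s := (Matrix.unitaryGroup A ℂ : Set (Op A)))).1 ?_
  refine Metric.isCompact_of_isClosed_isBounded isClosed_unitaryGroup ?_
  refine (isBounded_iff_forall_norm_le).2 ⟨1, fun U hU => ?_⟩
  exact entrywise_sup_norm_bound_of_unitary hU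

noncomputable instance measurableSpace_unitaryGroup : MeasurableSpace (Matrix.unitaryGroup A ℂ) :=
  borel _

instance borelSpace_unitaryGroup : BorelSpace (Matrix.unitaryGroup A ℂ) := ⟨rfl⟩

/-- The Haar probability measure of the unitary group. -/
noncomputable def haarUnitary (A : Type) [Fintype A] [DecidableEq A] :
    MeasureTheory.Measure (Matrix.unitaryGroup A ℂ) :=
  MeasureTheory.Measure.haarMeasure ⊤

instance isProbabilityMeasure_haarUnitary :
    MeasureTheory.IsProbabilityMeasure (haarUnitary A) := by
  constructor
  have h := MeasureTheory.Measure.haarMeasure_self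
    (K₀ := (⊤ : TopologicalSpace.PositiveCompacts (Matrix.unitaryGroup A ℂ)))
  simpa [haarUnitary] using h

instance isMulLeftInvariant_haarUnitary : (haarUnitary A).IsMulLeftInvariant := by
  unfold haarUnitary; infer_instance

/-- The average of a matrix-valued function over the unitary group. -/
noncomputable def haarAverage (F : Matrix.unitaryGroup A ℂ → Op ι) : Op ι :=
  ∫ V, F V ∂haarUnitary A

theorem integrable_haarUnitary {E : Type*} [NormedAddCommGroup E]
    {F : Matrix.unitaryGroup A ℂ → E} (hF : Continuous F) :
    MeasureTheory.Integrable F (haarUnitary A) :=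
  hF.integrable_of_hasCompactSupport (HasCompactSupport.of_compactSpace F)

theorem map_haarAverage {E : Type*} [NormedAddCommGroup E] [NormedSpace ℝ E] [CompleteSpace E]
    {F : Matrix.unitaryGroup A ℂ → Op ι} (hF : Continuous F) (l : Op ι →ₗ[ℝ] E) :
    l (haarAverage F) = ∫ V, l (F V) ∂haarUnitary A := by
  have : CompleteSpace (Op ι) := FiniteDimensional.complete ℂ _
  exact (l.toContinuousLinearMap.integral_comp_comm (integrable_haarUnitary hF)).symm

theorem haarAverage_mul_left (F : Matrix.unitaryGroup A ℂ → Op ι) (X : Matrix.unitaryGroup A ℂ) :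
    haarAverage (fun V => F (X * V)) = haarAverage F :=
  MeasureTheory.integral_mul_left_eq_self F X

theorem mul_haarAverage_mul {κ : Type} [Fintype κ]
    {F : Matrix.unitaryGroup A ℂ → Op ι} (hF : Continuous F) (M : Matrix κ ι ℂ)
    (N : Matrix ι κ ℂ) :
    M * haarAverage F * N = haarAverage fun V => M * F V * N := by
  have : CompleteSpace (Op κ) := FiniteDimensional.complete ℂ _
  let l : Op ι →ₗ[ℝ] Op κ :=
    { toFun := fun Y => M * Y * N
      map_add' := fun Y Z => by simp [Matrix.mul_add, Matrix.add_mul]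
      map_smul' := fun c Y => by simp }
  exact map_haarAverage hF l

theorem sum_haarAverage {J : Type} [Fintype J] {F : J → Matrix.unitaryGroup A ℂ → Op ι}
    (hF : ∀ j, Continuous (F j)) :
    ∑ j, haarAverage (F j) = haarAverage fun V => ∑ j, F j V :=
  (MeasureTheory.integral_finsetSum _ fun j _ => integrable_haarUnitary (hF j)).symm

theorem haarAverage_const (M : Op ι) :
    haarAverage (fun _ : Matrix.unitaryGroup A ℂ => M) = M := by
  have : CompleteSpace (Op ι) := FiniteDimensional.complete ℂ _
  simp [haarAverage]

theorem re_trace_haarAverage {F : Matrix.unitaryGroup A ℂ → Op ι} (hF : Continuous F) :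
    (haarAverage F).trace.re = ∫ V, (F V).trace.re ∂haarUnitary A := by
  let l : Op ι →ₗ[ℝ] ℝ :=
    { toFun := fun Y => Y.trace.re
      map_add' := fun Y Z => by simp
      map_smul' := fun c Y => by simp }
  exact map_haarAverage hF l

theorem haarAverage_posSemidef {F : Matrix.unitaryGroup A ℂ → Op ι} (hF : Continuous F)
    (h : ∀ V, (F V).PosSemidef) : (haarAverage F).PosSemidef := by
  have : CompleteSpace (Op ι) := FiniteDimensional.complete ℂ _
  refine Matrix.PosSemidef.of_dotProduct_mulVec_nonneg ?_ fun x => ?_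
  · let l : Op ι →ₗ[ℝ] Op ι :=
      { toFun := fun Y => Y.conjTranspose
        map_add' := fun Y Z => by simp
        map_smul' := fun c Y => by simp }
    have := map_haarAverage hF l
    change (haarAverage F).conjTranspose = _ at this
    rw [Matrix.IsHermitian, this]
    simp only [l, LinearMap.coe_mk, AddHom.coe_mk, (h _).1.eq]
    rfl
  · let l : Op ι →ₗ[ℝ] ℂ :=
      { toFun := fun Y => star x ⬝ᵥ Y.mulVec x
        map_add' := fun Y Z => by simp [Matrix.add_mulVec]
        map_smul' := fun c Y => by simp [Matrix.smul_mulVec] }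
    have := map_haarAverage hF l
    change star x ⬝ᵥ (haarAverage F).mulVec x = _ at this
    rw [this]
    exact MeasureTheory.integral_nonneg fun V => (h V).dotProduct_mulVec_nonneg x

end Haar

/-- A positive semidefinite matrix has a Hermitian square root that commutes with everything
that the matrix commutes with. -/
theorem exists_sqrt_commute {ι : Type} [Fintype ι] [DecidableEq ι] {T : Op ι}
    (hT : T.PosSemidef) :
    ∃ S : Op ι, S.IsHermitian ∧ S * S = T ∧ ∀ N, Commute T N → Commute S N := by
  open scoped MatrixOrder Matrix.Norms.L2Operator in
  refine ⟨CFC.sqrt T, ?_, ?_, fun N hN => ?_⟩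
  · exact (Matrix.nonneg_iff_posSemidef.1 (CFC.sqrt_nonneg T)).1
  · exact CFC.sqrt_mul_sqrt_self T (Matrix.nonneg_iff_posSemidef.2 hT)
  · exact hN.cfcₙ_nnreal _

/-! ### Random purifications -/

section Purification

variable {A : Type} [DecidableEq A]

/-- Basis labels of a flag qubit, a system and its purifying environment. -/
abbrev Flagged (A : Type) : Type := Fin 2 × (A × A)

/-- The operator that acts on the system as `X` if the flag is `1`, and as the identity if the
flag is `0`. -/
def flagged (X : Op A) : Op (Flagged A) :=
  Matrix.single 0 0 1 ⊗ₖ (1 : Op (A × A)) + Matrix.single 1 1 1 ⊗ₖ (X ⊗ₖ (1 : Op A))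

theorem flagged_mul [Fintype A] (X Y : Op A) : flagged X * flagged Y = flagged (X * Y) := by
  simp [flagged, add_mul, mul_add, ← Matrix.mul_kronecker_mul]

theorem flagged_conjTranspose (X : Op A) :
    (flagged X).conjTranspose = flagged X.conjTranspose := by
  simp [flagged, Matrix.conjTranspose_kronecker]

theorem single_add_single : (Matrix.single 0 0 1 + Matrix.single 1 1 1 : Op (Fin 2)) = 1 := by
  ext i j; fin_cases i <;> fin_cases j <;> simp

theorem flagged_one : flagged (1 : Op A) = 1 := by
  rw [flagged, Matrix.one_kronecker_one, ← Matrix.add_kronecker, single_add_single,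
    Matrix.one_kronecker_one]

/-- The factor that `flagged (diagonal r)` puts on a basis vector. -/
def flaggedWeight (r : A → ℂ) (h : Flagged A) : ℂ := if h.1 = 0 then 1 else r h.2.1

theorem flagged_diagonal (r : A → ℂ) :
    flagged (Matrix.diagonal r) = Matrix.diagonal (flaggedWeight r) := by
  ext ⟨f, a, b⟩ ⟨f', a', b'⟩
  fin_cases f <;> fin_cases f' <;>
    simp [flagged, flaggedWeight, Matrix.diagonal_apply, Matrix.one_apply,
      Prod.ext_iff]
  split_ifs <;> simp_all

/-! ### Commutation with tensor powers of diagonal matrices -/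

theorem tensorProd_diagonal {α : Type} [DecidableEq α] {k : ℕ} (d : α → ℂ) :
    tensorProd (fun _ : Fin k => Matrix.diagonal d) =
      Matrix.diagonal fun x : Fin k → α => ∏ i, d (x i) := by
  ext x y
  simp only [tensorProd_apply, Matrix.diagonal_apply, Finset.prod_ite_zero,
    Finset.mem_univ, true_imp_iff, funext_iff]

theorem commute_diagonal_iff {α : Type} [Fintype α] [DecidableEq α] (T : Op α) (d : α → ℂ) :
    Commute T (Matrix.diagonal d) ↔ ∀ x y, T x y ≠ 0 → d x = d y := by
  simp only [Commute, SemiconjBy, ← Matrix.ext_iff, Matrix.mul_diagonal, Matrix.diagonal_mul]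
  refine forall₂_congr fun x y => ?_
  rw [mul_comm, mul_eq_mul_right_iff, eq_comm, or_iff_not_imp_right]

variable [Fintype A]

/-- The diagonal entries of `(1 ⊕ diag r ⊗ 1)^{⊗k}` are monomials in `r` whose exponents are
occurrence counts, hence at most `k`. -/
theorem prod_flaggedWeight {k : ℕ} (r : A → ℂ) (x : Fin k → Flagged A) :
    ∏ i, flaggedWeight r (x i) =
      ∏ a, r a ^ (Finset.univ.filter fun i => (x i).1 ≠ 0 ∧ (x i).2.1 = a).card := by
  have h : ∀ h : Flagged A,
      flaggedWeight r h = ∏ a, if h.1 ≠ 0 ∧ h.2.1 = a then r a else 1 := by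
    rintro ⟨f, a, b⟩
    by_cases hf : f = 0 <;> simp [flaggedWeight, hf]
  simp only [h]
  rw [Finset.prod_comm]
  refine Finset.prod_congr rfl fun a _ => ?_
  rw [Finset.prod_ite]
  simp

/-- A matrix that commutes with `(1 ⊕ X)^{⊗k}` for all diagonal unitaries `X` does so for all
diagonal `X`. -/
theorem commute_flagged_diagonal {k : ℕ} {T : Op (Fin k → Flagged A)}
    (hT : ∀ r : A → ℂ, (∀ a, star (r a) * r a = 1) →
      Commute T (tensorProd fun _ => flagged (Matrix.diagonal r)))
    (r : A → ℂ) : Commute T (tensorProd fun _ => flagged (Matrix.diagonal r)) := by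
  simp only [flagged_diagonal, tensorProd_diagonal, commute_diagonal_iff] at hT ⊢
  intro x y hxy
  rw [prod_flaggedWeight, prod_flaggedWeight]
  refine Finset.prod_congr rfl fun a _ => ?_
  congr 1
  -- Placing a root of unity of order `k + 1` at the single label `a` isolates the exponent of `r
  -- a`. Exponents are below `k + 1`, so the power of `z` determines them.
  set z : ℂ := Complex.exp (2 * Real.pi * Complex.I / ((k + 1 : ℕ) : ℂ))
  have hz : IsPrimitiveRoot z (k + 1) := Complex.isPrimitiveRoot_exp _ (Nat.succ_ne_zero k)
  have hz1 : star z * z = 1 := by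
    have := hz.norm'_eq_one (Nat.succ_ne_zero k)
    rw [← starRingEnd_apply, mul_comm, Complex.mul_conj, Complex.normSq_eq_norm_sq, this]
    simp
  have h := hT (Function.update 1 a z) (fun b => by
    by_cases hb : b = a
    · subst hb; simpa using hz1
    · simp [hb]) x y hxy
  rw [prod_flaggedWeight, prod_flaggedWeight] at h
  have key : ∀ e : A → ℕ, ∏ b, Function.update (1 : A → ℂ) a z b ^ e b = z ^ e a := by
    intro e
    rw [Finset.prod_eq_single a]
    · simp
    · intro b _ hb; simp [hb]
    · simp
  rw [key (fun b => (Finset.univ.filter fun i => (x i).1 ≠ 0 ∧ (x i).2.1 = b).card),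
    key (fun b => (Finset.univ.filter fun i => (y i).1 ≠ 0 ∧ (y i).2.1 = b).card)] at h
  have hk : ∀ s : Finset (Fin k), s.card < k + 1 := fun s =>
    Nat.lt_succ_of_le (by simpa using s.card_le_univ)
  exact hz.pow_inj (hk _) (hk _) h

/-- Kraus operators of the channel `ρ ↦ 1 ⊕ (ρ ⊗ 1)`. -/
def purifKraus : ((A × A) × A) ⊕ A → Matrix (Flagged A) A ℂ
  | .inl (c, a) => Matrix.single (0, c) a 1
  | .inr b => Matrix.of fun h a => if h = (1, (a, b)) then 1 else 0

/-- Unit trace lets the constant block `1` be written as `tr ρ • 1`. This makes `1 ⊕ (ρ ⊗ 1)` linear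
in `ρ`, and its tensor power linear in `ρ^{⊗k}`. -/
theorem sum_purifKraus_mul (ρ : Op A) (hρ : ρ.trace = 1) :
    ∑ j : ((A × A) × A) ⊕ A, purifKraus j * ρ * (purifKraus j).conjTranspose = flagged ρ := by
  rw [Fintype.sum_sum_type, flagged]
  congr 1
  · have h : ∀ p : (A × A) × A, purifKraus (.inl p) * ρ * (purifKraus (.inl p)).conjTranspose =
        ρ p.2 p.2 • Matrix.single (0, p.1) (0, p.1) (1 : ℂ) := by
      rintro ⟨c, a⟩
      simp [purifKraus, Matrix.conjTranspose_single]
    simp only [h]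
    rw [Fintype.sum_prod_type]
    simp only [← Finset.sum_smul]
    have h1 : ∑ a, ρ a a = 1 := hρ
    simp only [h1, one_smul]
    ext ⟨f, c⟩ ⟨f', c'⟩
    simp [Matrix.sum_apply, Matrix.single_apply, Matrix.one_apply, ite_and]
    split_ifs <;> rfl
  · ext ⟨f, a, b⟩ ⟨f', a', b'⟩
    rcases eq_or_ne b b' with rfl | hb
    · fin_cases f <;> fin_cases f' <;>
        simp [Matrix.sum_apply, Matrix.mul_apply, purifKraus, ite_and, apply_ite]
    · fin_cases f <;> fin_cases f' <;>
        simp [Matrix.sum_apply, Matrix.mul_apply, purifKraus, ite_and, hb, hb.symm]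


/-! ### The vector to reflect about, and its Haar average -/

theorem inv_sqrt_two_mul_self : ((√2 : ℝ) : ℂ)⁻¹ * ((√2 : ℝ) : ℂ)⁻¹ = 1 / 2 := by
  rw [← mul_inv, ← Complex.ofReal_mul, Real.mul_self_sqrt (by norm_num)]; simp

/-- The vector `(|⊥⟩ - |Ψ⟩) / √2`, where `⊥` is the zero label (with flag `0`) and `|Ψ⟩` is the
vector with amplitudes `Ψ a b` (and flag `1`). If `Ψ Ψ† = ρ`, then `|Ψ⟩` is a purification
of `ρ`. -/
noncomputable def purifVec {A : Type} [DecidableEq A] [Zero A] (Ψ : Op A) :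
    Flagged A → ℂ := fun h =>
  ((√2 : ℝ) : ℂ)⁻¹ * if h.1 = 0 then (if h.2 = 0 then 1 else 0) else -Ψ h.2.1 h.2.2

variable [Zero A]

theorem flagged_mulVec_purifVec (X Ψ : Op A) :
    (flagged X).mulVec (purifVec Ψ) = purifVec (X * Ψ) := by
  ext ⟨f, a, b⟩
  fin_cases f <;>
  simp [Matrix.mulVec, dotProduct, Fintype.sum_prod_type, flagged, purifVec, Matrix.single_apply,
    Matrix.one_apply, Matrix.mul_apply, Finset.mul_sum, Prod.ext_iff, ite_and]
  exact Finset.sum_congr rfl fun i _ => by ring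

theorem continuous_purifVec {A : Type} [DecidableEq A] [Zero A] :
    Continuous (purifVec (A := A)) := by
  refine continuous_pi fun h => continuous_const.mul ?_
  split_ifs <;> fun_prop

/-- The component along `|⊥⟩` contributes `1 / 2` and the component along `|V⟩` contributes `V V† /
2`. Averaged over `V`, this becomes the normalisation of the sample tester. -/
theorem sum_purifKraus_conj (V : Op A) (hV : V * V.conjTranspose = 1) :
    ∑ j : ((A × A) × A) ⊕ A, (purifKraus j).conjTranspose *
      Matrix.vecMulVec (purifVec V) (star (purifVec V)) * purifKraus j = 1 := by
  have h2 := inv_sqrt_two_mul_self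
  rw [Fintype.sum_sum_type]
  have h : (1 : Op A) = (1 / 2 : ℂ) • 1 + (1 / 2 : ℂ) • (V * V.conjTranspose) := by
    rw [hV, ← add_smul]; norm_num
  rw [h]
  congr 1
  · have h : ∀ p : (A × A) × A, (purifKraus (.inl p)).conjTranspose *
        Matrix.vecMulVec (purifVec V) (star (purifVec V)) * purifKraus (.inl p) =
        (if p.1 = 0 then (1 / 2 : ℂ) else 0) • Matrix.single p.2 p.2 (1 : ℂ) := by
      rintro ⟨c, a⟩
      simp [purifKraus, Matrix.conjTranspose_single, Matrix.vecMulVec_apply, purifVec]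
      split_ifs with hc
      · simp [h2]
      · simp
    simp only [h]
    rw [Fintype.sum_prod_type]
    simp only [ite_smul, zero_smul, Finset.sum_ite_irrel, Finset.sum_const_zero,
      Finset.sum_ite_eq', Finset.mem_univ, if_true]
    ext a b
    simp [Matrix.sum_apply, Matrix.single_apply, Matrix.one_apply, ite_and]
  · have h : ∀ b : A, (purifKraus (.inr b)).conjTranspose.mulVec (purifVec V) =
        fun a => -(((√2 : ℝ) : ℂ)⁻¹ * V a b) := by
      intro b
      ext a
      simp [Matrix.mulVec, dotProduct, purifKraus, purifVec, Fintype.sum_prod_type, ite_and]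
    simp only [Matrix.mul_vecMulVec, Matrix.vecMulVec_mul]
    ext a a'
    have h' : ∀ b : A, Matrix.vecMul (star (purifVec V)) (purifKraus (.inr b)) =
        star fun a => -(((√2 : ℝ) : ℂ)⁻¹ * V a b) := by
      intro b
      rw [← h, Matrix.star_mulVec, Matrix.conjTranspose_conjTranspose]
    simp only [Matrix.sum_apply, h, h', Matrix.vecMulVec_apply, Matrix.smul_apply, Matrix.mul_apply,
      Finset.smul_sum, ← h2]
    refine Finset.sum_congr rfl fun b _ => ?_
    simp
    ring

/-- The average of `|φ⟩⟨φ|^{⊗k}` over the vectors `φ = purifVec V` with `V` unitary. -/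
noncomputable def purifAverage (A : Type) [Fintype A] [DecidableEq A] [Zero A] (k : ℕ) :
    Op (Fin k → Flagged A) :=
  haarAverage fun V : Matrix.unitaryGroup A ℂ =>
    tensorProd fun _ => Matrix.vecMulVec (purifVec (V : Op A)) (star (purifVec (V : Op A)))

theorem continuous_tensorProd_purifVec (k : ℕ) : Continuous fun V : Matrix.unitaryGroup A ℂ =>
    tensorProd fun _ : Fin k =>
      Matrix.vecMulVec (purifVec (V : Op A)) (star (purifVec (V : Op A))) := by
  have h : Continuous fun V : Matrix.unitaryGroup A ℂ => purifVec (V : Op A) :=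
    continuous_purifVec.comp continuous_subtype_val
  have h' : ∀ a, Continuous fun V : Matrix.unitaryGroup A ℂ => purifVec (V : Op A) a :=
    fun a => (continuous_apply a).comp h
  refine continuous_matrix fun x y => ?_
  simp only [tensorProd_apply, Matrix.vecMulVec_apply, Pi.star_apply]
  exact continuous_finsetProd _ fun i _ => (h' _).mul (h' _).star

theorem tensorProd_flagged_mul_purif {k : ℕ} (X Ψ : Op A) :
    tensorProd (fun _ : Fin k => flagged X) *
        (tensorProd fun _ => Matrix.vecMulVec (purifVec Ψ) (star (purifVec Ψ))) *
        (tensorProd fun _ => flagged X).conjTranspose =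
      tensorProd fun _ => Matrix.vecMulVec (purifVec (X * Ψ)) (star (purifVec (X * Ψ))) := by
  rw [tensorProd_conjTranspose, tensorProd_mul, tensorProd_mul, ← flagged_mulVec_purifVec]
  congr; funext i
  rw [Matrix.mul_vecMulVec, Matrix.vecMulVec_mul, Matrix.star_mulVec]

theorem purifAverage_posSemidef (k : ℕ) : (purifAverage A k).PosSemidef := by
  refine haarAverage_posSemidef (continuous_tensorProd_purifVec k) fun V => ?_
  rw [tensorProd_vecMulVec]
  exact Matrix.posSemidef_vecMulVec_self_star _

/-- Conjugation by `(1 ⊕ X ⊗ 1)^{⊗k}` replaces `V` by `X V`, which left invariance of Haar measure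
undoes. -/
theorem commute_purifAverage_unitary (k : ℕ) (X : Matrix.unitaryGroup A ℂ) :
    Commute (purifAverage A k) (tensorProd fun _ => flagged (X : Op A)) := by
  set D := tensorProd fun _ : Fin k => flagged (X : Op A) with hD
  have h1 : D * purifAverage A k * D.conjTranspose = purifAverage A k := by
    rw [purifAverage, mul_haarAverage_mul (continuous_tensorProd_purifVec k)]
    simp only [hD, tensorProd_flagged_mul_purif]
    exact haarAverage_mul_left (fun V : Matrix.unitaryGroup A ℂ => tensorProd fun _ : Fin k =>
      Matrix.vecMulVec (purifVec (V : Op A)) (star (purifVec (V : Op A)))) X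
  have h2 : D.conjTranspose * D = 1 := by
    rw [hD, tensorProd_conjTranspose, tensorProd_mul, flagged_conjTranspose, flagged_mul,
      ← Matrix.star_eq_conjTranspose, Matrix.UnitaryGroup.star_mul_self, flagged_one,
      tensorProd_one]
  calc purifAverage A k * D = D * purifAverage A k * D.conjTranspose * D := by rw [h1]
    _ = D * purifAverage A k := by rw [mul_assoc, h2, mul_one]

/-- The two outer factors are unitary, and the diagonal one need not be, by
`commute_flagged_diagonal`. The case of interest is `W diag(r) W† = √ρ`. -/
theorem commute_purifAverage (k : ℕ) (W : Matrix.unitaryGroup A ℂ) (r : A → ℂ) :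
    Commute (purifAverage A k)
      (tensorProd fun _ => flagged ((W : Op A) * Matrix.diagonal r * star (W : Op A))) := by
  simp only [← flagged_mul, ← tensorProd_mul]
  refine ((commute_purifAverage_unitary k W).mul_right ?_).mul_right
    (commute_purifAverage_unitary k (star W))
  refine commute_flagged_diagonal (fun r hr => ?_) r
  refine commute_purifAverage_unitary k ⟨Matrix.diagonal r, ?_⟩
  rw [Matrix.mem_unitaryGroup_iff', Matrix.star_eq_conjTranspose, Matrix.diagonal_conjTranspose,
    Matrix.diagonal_mul_diagonal, ← Matrix.diagonal_one]
  congr 1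
  funext a
  exact hr a

theorem sum_purifKraus_purifAverage (k : ℕ) :
    ∑ j : Fin k → ((A × A) × A) ⊕ A, (tensorProd fun i => purifKraus (j i)).conjTranspose *
      purifAverage A k * (tensorProd fun i => purifKraus (j i)) = 1 := by
  simp only [purifAverage, mul_haarAverage_mul (continuous_tensorProd_purifVec k)]
  rw [sum_haarAverage]
  · rw [← haarAverage_const (A := A) 1]
    congr 1
    funext V
    simp only [tensorProd_conjTranspose, tensorProd_mul]
    rw [sum_tensorProd (fun j => (purifKraus j).conjTranspose *
      Matrix.vecMulVec (purifVec (V : Op A)) (star (purifVec (V : Op A))) * purifKraus j),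
      sum_purifKraus_conj _ (Matrix.mem_unitaryGroup_iff.1 V.2), tensorProd_one]
  · intro j
    exact (continuous_const.matrix_mul (continuous_tensorProd_purifVec k)).matrix_mul
      continuous_const

end Purification

/-- Every density operator is `X ^ 2` for a Hermitian `X` that is diagonalised by a unitary. -/
theorem DensityOperator.exists_sqrt {n : ℕ} (ρ : DensityOperator n) :
    ∃ (W : Matrix.unitaryGroup (Qubits n) ℂ) (r : Qubits n → ℂ) (X : Op (Qubits n)),
      X = (W : Op (Qubits n)) * Matrix.diagonal r * star (W : Op (Qubits n)) ∧
      X.IsHermitian ∧ X * X = ρ.mat := by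
  have hρ := ρ.posSemidef
  set W := hρ.1.eigenvectorUnitary
  set d : Qubits n → ℂ := fun i => ((√(hρ.1.eigenvalues i) : ℝ) : ℂ) with hd
  refine ⟨W, d, _, rfl, ?_, ?_⟩
  · rw [Matrix.IsHermitian, Matrix.star_eq_conjTranspose, Matrix.conjTranspose_mul,
      Matrix.conjTranspose_mul, Matrix.conjTranspose_conjTranspose, Matrix.diagonal_conjTranspose,
      mul_assoc]
    congr 3
    funext i
    simp [hd]
  · have hW : star (W : Op (Qubits n)) * (W : Op (Qubits n)) = 1 :=
      Matrix.UnitaryGroup.star_mul_self W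
    have h := hρ.1.spectral_theorem
    rw [Unitary.conjStarAlgAut_apply] at h
    refine Eq.trans ?_ h.symm
    calc _ = (W : Op (Qubits n)) * Matrix.diagonal d *
          (star (W : Op (Qubits n)) * (W : Op (Qubits n))) * Matrix.diagonal d *
            star (W : Op (Qubits n)) := by simp only [mul_assoc]
      _ = _ := by
        rw [hW, mul_one, mul_assoc (W : Op (Qubits n)), Matrix.diagonal_mul_diagonal]
        congr 3
        funext i
        rw [hd, ← Complex.ofReal_mul, Real.mul_self_sqrt (hρ.eigenvalues_nonneg i)]
        rfl

/-- A measurement of `k` copies of the vector `purifVec Ψ` gives a measurement of `k` samples of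
`ρ`, whose acceptance probability is an average of those for `Ψ` with `Ψ Ψ† = ρ`. -/
theorem exists_sampleTester {n k : ℕ} {M : Op (Fin k → Flagged (Qubits n))}
    (hM : M.PosSemidef) (hM' : (1 - M).PosSemidef) :
    ∃ T : SampleTester n k, ∀ (ρ : DensityOperator n) (I : Set ℝ), Convex ℝ I → IsClosed I →
      (∀ Ψ : Op (Qubits n), Ψ * Ψ.conjTranspose = ρ.mat →
        (M * Matrix.vecMulVec (tensorVec k (purifVec Ψ))
          (star (tensorVec k (purifVec Ψ)))).trace.re ∈ I) → T.acceptProb ρ ∈ I := by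
  obtain ⟨S, hS, hSS, hcomm⟩ := exists_sqrt_commute (purifAverage_posSemidef (A := Qubits n) k)
  set K : (Fin k → ((Qubits n × Qubits n) × Qubits n) ⊕ Qubits n) →
    Matrix (Fin k → Flagged (Qubits n)) (Fin k → Qubits n) ℂ :=
    fun j => tensorProd fun i => purifKraus (j i) with hK
  have hpos : ∀ N : Op (Fin k → Flagged (Qubits n)), N.PosSemidef →
      (∑ j, (K j).conjTranspose * (S * N * S) * K j).PosSemidef := by
    intro N hN
    refine Matrix.posSemidef_sum _ fun j _ => ?_
    refine Matrix.PosSemidef.conjTranspose_mul_mul_same ?_ _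
    have := hN.conjTranspose_mul_mul_same S
    rwa [hS.eq] at this
  -- This is `M` pulled back along `σ ↦ ∑ j, S K_j σ K_j† S`. Its complement is the pullback of `1 -
  -- M`, because `1` pulls back to `∑ j, K_j† T K_j = 1` with `T = S²`.
  refine ⟨⟨∑ j, (K j).conjTranspose * (S * M * S) * K j, hpos M hM, ?_⟩, ?_⟩
  · have h : (1 : Op (Fin k → Qubits n)) - ∑ j, (K j).conjTranspose * (S * M * S) * K j =
        ∑ j, (K j).conjTranspose * (S * (1 - M) * S) * K j := by
      rw [← sum_purifKraus_purifAverage k, ← Finset.sum_sub_distrib]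
      refine Finset.sum_congr rfl fun j _ => ?_
      rw [← Matrix.sub_mul, ← Matrix.mul_sub, ← hSS, mul_sub, mul_one, sub_mul]
    rw [h]
    exact hpos _ hM'
  · intro ρ I hI hI' hΨ
    obtain ⟨W, r, X, hX, hXh, hXX⟩ := ρ.exists_sqrt
    set D := tensorProd fun _ : Fin k => flagged X with hD
    have hDh : D.conjTranspose = D := by
      rw [hD, tensorProd_conjTranspose, flagged_conjTranspose, hXh.eq]
    have hDD : D * D = tensorProd fun _ : Fin k => flagged ρ.mat := by
      rw [hD, tensorProd_mul, flagged_mul, hXX]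
    have hTD : Commute (purifAverage (Qubits n) k) D := by
      rw [hD, hX]; exact commute_purifAverage k W r
    have hSD : Commute S D := hcomm _ hTD
    have h1 : (∑ j, (K j).conjTranspose * (S * M * S) * K j * copies ρ k).trace =
        (M * (D * purifAverage (Qubits n) k * D.conjTranspose)).trace := by
      have h2 : ∑ j, K j * copies ρ k * (K j).conjTranspose = D * D := by
        rw [hDD]
        simp only [hK, tensorProd_conjTranspose]
        rw [← sum_purifKraus_mul ρ.mat ρ.trace_eq_one,
          ← sum_tensorProd (fun j => purifKraus j * ρ.mat * (purifKraus j).conjTranspose)]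
        simp only [← tensorProd_mul]
        rfl
      calc _ = ∑ j, ((S * M * S) * (K j * copies ρ k * (K j).conjTranspose)).trace := by
            rw [Matrix.trace_sum]
            refine Finset.sum_congr rfl fun j _ => ?_
            rw [Matrix.mul_assoc, Matrix.mul_assoc, Matrix.trace_mul_comm]
            simp only [Matrix.mul_assoc]
        _ = (S * (M * S * (D * D))).trace := by
            rw [← Matrix.trace_sum, ← Matrix.mul_sum, h2]
            simp only [mul_assoc]
        _ = (M * (D * (S * S) * D)).trace := by
            rw [Matrix.trace_mul_comm]
            -- Here commutation pays off: the left side contains only `D² = (1 ⊕ ρ ⊗ 1)^{⊗k}`,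
            -- reachable from samples, while the right side is the average over random
            -- purifications.
            have h4 : S * (D * D) * S = D * (S * S) * D := by
              rw [← mul_assoc, hSD.eq, mul_assoc D, mul_assoc D, mul_assoc S, ← hSD.eq]
              simp only [mul_assoc]
            rw [← h4]
            simp only [mul_assoc]
        _ = _ := by rw [hSS, hDh]
    have hcont : Continuous fun V : Matrix.unitaryGroup (Qubits n) ℂ =>
        M * (D * (tensorProd fun _ : Fin k => Matrix.vecMulVec (purifVec (V : Op (Qubits n)))
          (star (purifVec (V : Op (Qubits n))))) * D.conjTranspose) :=
      continuous_const.matrix_mul ((continuous_const.matrix_mul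
        (continuous_tensorProd_purifVec k)).matrix_mul continuous_const)
    have h3 : M * (D * purifAverage (Qubits n) k * D.conjTranspose) =
        haarAverage fun V : Matrix.unitaryGroup (Qubits n) ℂ =>
          M * (D * (tensorProd fun _ : Fin k => Matrix.vecMulVec (purifVec (V : Op (Qubits n)))
            (star (purifVec (V : Op (Qubits n))))) * D.conjTranspose) := by
      have h4 := mul_haarAverage_mul (continuous_tensorProd_purifVec (A := Qubits n) k)
        (M * D) D.conjTranspose
      simpa only [purifAverage, mul_assoc] using h4
    simp only [SampleTester.acceptProb]
    rw [Finset.sum_mul, h1, h3, re_trace_haarAverage hcont]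
    have hre : Continuous fun V : Matrix.unitaryGroup (Qubits n) ℂ =>
        (M * (D * (tensorProd fun _ : Fin k => Matrix.vecMulVec (purifVec (V : Op (Qubits n)))
          (star (purifVec (V : Op (Qubits n))))) * D.conjTranspose)).trace.re :=
      Complex.continuous_re.comp hcont.matrix_trace
    -- The acceptance probability is the Haar mean of those for `Ψ = X V`, each in `I` since `X V V†
    -- X = X² = ρ`.
    refine hI.integral_mem hI' (Filter.Eventually.of_forall fun V => ?_)
      (integrable_haarUnitary hre)
    rw [hD, tensorProd_flagged_mul_purif, tensorProd_vecMulVec]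
    refine hΨ _ ?_
    rw [Matrix.conjTranspose_mul, Matrix.mul_assoc, ← Matrix.mul_assoc (V : Op (Qubits n)),
      ← Matrix.star_eq_conjTranspose (V : Op (Qubits n)), Matrix.mem_unitaryGroup_iff.1 V.2,
      Matrix.one_mul, hXh.eq, hXX]

/-! ### Euclidean norms of amplitude vectors -/

section L2Norm

variable {ι κ : Type} [Fintype ι] [Fintype κ]

/-- The Euclidean norm of a vector of amplitudes. -/
noncomputable def l2norm (v : ι → ℂ) : ℝ := ‖(WithLp.toLp 2 v : EuclideanSpace ℂ ι)‖

theorem l2norm_nonneg (v : ι → ℂ) : 0 ≤ l2norm v := norm_nonneg _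

theorem l2norm_sq (v : ι → ℂ) : l2norm v ^ 2 = ∑ i, ‖v i‖ ^ 2 := by
  simp [l2norm, EuclideanSpace.norm_sq_eq]

theorem ofReal_l2norm_sq (v : ι → ℂ) : ((l2norm v ^ 2 : ℝ) : ℂ) = star v ⬝ᵥ v := by
  rw [l2norm_sq]
  simp [dotProduct, ← Complex.conj_mul']

theorem l2norm_add_le (v w : ι → ℂ) : l2norm (v + w) ≤ l2norm v + l2norm w :=
  norm_add_le (WithLp.toLp 2 v : EuclideanSpace ℂ ι) (WithLp.toLp 2 w)

theorem l2norm_mulVec [DecidableEq κ] {U : Matrix ι κ ℂ} (hU : U.conjTranspose * U = 1)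
    (v : κ → ℂ) : l2norm (U.mulVec v) = l2norm v := by
  rw [← sq_eq_sq₀ (l2norm_nonneg _) (l2norm_nonneg _), ← Complex.ofReal_inj, ofReal_l2norm_sq,
    ofReal_l2norm_sq, Matrix.star_mulVec, Matrix.dotProduct_mulVec, Matrix.vecMul_vecMul, hU,
    Matrix.vecMul_one]

end L2Norm

/-! ### Simulating a reflection with copies of the reflected vector -/

theorem reflection_mul_self {ι : Type} [Fintype ι] [DecidableEq ι] {P : Op ι} (hP : P * P = P) :
    (1 - (2 : ℂ) • P) * (1 - (2 : ℂ) • P) = 1 := by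
  simp only [sub_mul, mul_sub, one_mul, mul_one, smul_mul_smul_comm, hP]
  module

theorem reflection_isHermitian {ι : Type} [DecidableEq ι] {P : Op ι} (hP : P.IsHermitian) :
    (1 - (2 : ℂ) • P).conjTranspose = 1 - (2 : ℂ) • P := by
  simp [hP.eq]

section Cyclic

variable {H : Type}

/-- The vector `f 0 ⊗ ⋯ ⊗ f (m - 1)`. -/
def prodVec {m : ℕ} (f : Fin m → H → ℂ) : (Fin m → H) → ℂ := fun x => ∏ i, f i (x i)

theorem star_prodVec_dotProduct [Fintype H] {m : ℕ} (f g : Fin m → H → ℂ) :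
    star (prodVec f) ⬝ᵥ prodVec g = ∏ i, star (f i) ⬝ᵥ g i := by
  simp only [dotProduct, prodVec, Pi.star_apply, star_prod, ← Finset.prod_mul_distrib]
  rw [Finset.prod_univ_sum, Fintype.piFinset_univ]

theorem prodVec_cons_sub {k : ℕ} (v w φ : H → ℂ) :
    prodVec (Fin.cons (v - w) fun _ : Fin k => φ) =
      prodVec (Fin.cons v fun _ => φ) - prodVec (Fin.cons w fun _ => φ) := by
  ext x
  simp [prodVec, Fin.prod_univ_succ, sub_mul]

theorem prodVec_cons_smul {k : ℕ} (c : ℂ) (v φ : H → ℂ) :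
    prodVec (Fin.cons (c • v) fun _ : Fin k => φ) = c • prodVec (Fin.cons v fun _ => φ) := by
  ext x
  simp [prodVec, Fin.prod_univ_succ, mul_assoc]

variable [DecidableEq H]

/-- The projection of `H^{⊗(k+1)}` onto the vectors invariant under cyclic shifts of the
factors. -/
noncomputable def cyclicProj (H : Type) [DecidableEq H] (k : ℕ) : Op (Fin (k + 1) → H) :=
  Matrix.of fun x y => ((k : ℂ) + 1)⁻¹ * ∑ j, if (fun i => x (i + j)) = y then 1 else 0

theorem cyclicProj_isHermitian (k : ℕ) : (cyclicProj H k).IsHermitian := by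
  ext x y
  simp only [Matrix.conjTranspose_apply, cyclicProj, Matrix.of_apply]
  rw [← Equiv.sum_comp (Equiv.neg (Fin (k + 1)))]
  simp only [star_mul', star_inv₀, star_add, star_sum, star_one, star_natCast, apply_ite star,
    star_zero]
  congr 1
  refine Finset.sum_congr rfl fun j _ => if_congr ⟨?_, ?_⟩ rfl rfl
  · rintro rfl; funext i; simp
  · rintro rfl; funext i; simp

variable [Fintype H]

theorem cyclicProj_mulVec (k : ℕ) (u : (Fin (k + 1) → H) → ℂ) (x : Fin (k + 1) → H) :
    (cyclicProj H k).mulVec u x = ((k : ℂ) + 1)⁻¹ * ∑ j, u fun i => x (i + j) := by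
  simp only [Matrix.mulVec, dotProduct, cyclicProj, Matrix.of_apply, mul_assoc, ← Finset.mul_sum,
    Finset.sum_mul]
  rw [Finset.sum_comm]
  simp

theorem cyclicProj_mul_self (k : ℕ) : cyclicProj H k * cyclicProj H k = cyclicProj H k := by
  refine Matrix.ext_of_mulVec_single fun y => ?_
  rw [← Matrix.mulVec_mulVec]
  ext x
  have hk : ((k : ℂ) + 1) ≠ 0 := Nat.cast_add_one_ne_zero k
  simp only [cyclicProj_mulVec (k := k)]
  generalize (Pi.single y 1 : (Fin (k + 1) → H) → ℂ) = u
  have h : ∀ j : Fin (k + 1), ∑ l, u (fun i => x (i + l + j)) = ∑ l, u fun i => x (i + l) := by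
    intro j
    rw [← Equiv.sum_comp (Equiv.addRight j) fun l => u fun i => x (i + l)]
    simp [add_assoc]
  simp only [h, Finset.sum_const, Finset.card_univ, Fintype.card_fin, nsmul_eq_mul]
  push_cast
  field_simp

theorem cyclicProj_mulVec_prodVec {k : ℕ} (f : Fin (k + 1) → H → ℂ) :
    (cyclicProj H k).mulVec (prodVec f) =
      ((k : ℂ) + 1)⁻¹ • ∑ j : Fin (k + 1), prodVec fun i => f (i - j) := by
  ext x
  rw [cyclicProj_mulVec]
  simp only [Pi.smul_apply, Finset.sum_apply, smul_eq_mul, prodVec]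
  congr 1
  refine Finset.sum_congr rfl fun j _ => ?_
  rw [← Equiv.prod_comp (Equiv.subRight j)]
  simp

theorem cyclicProj_mulVec_cons_same {k : ℕ} (φ : H → ℂ) :
    (cyclicProj H k).mulVec (prodVec (Fin.cons φ fun _ => φ)) =
      prodVec (Fin.cons φ fun _ => φ) := by
  have h : (Fin.cons φ fun _ => φ : Fin (k + 1) → H → ℂ) = fun _ => φ := by
    funext i; refine Fin.cases ?_ (fun _ => ?_) i <;> simp
  have hk : ((k : ℂ) + 1) ≠ 0 := Nat.cast_add_one_ne_zero k
  rw [h, cyclicProj_mulVec_prodVec]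
  simp only [Finset.sum_const, Finset.card_univ, Fintype.card_fin, ← Nat.cast_smul_eq_nsmul ℂ,
    smul_smul]
  push_cast
  rw [inv_mul_cancel₀ hk, one_smul]

/-- The squared norm is the mean of the inner products of `v ⊗ φ^{⊗k}` with its `k + 1` cyclic
shifts. A nontrivial shift pairs `v` with `φ`, giving zero, so only the unshifted term survives. -/
theorem l2norm_cyclicProj_cons {k : ℕ} {φ v : H → ℂ} (hφ : star φ ⬝ᵥ φ = 1)
    (hv : star v ⬝ᵥ φ = 0) :
    l2norm ((cyclicProj H k).mulVec (prodVec (Fin.cons v fun _ => φ))) ^ 2 =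
      ((k : ℝ) + 1)⁻¹ * l2norm v ^ 2 := by
  rw [← Complex.ofReal_inj, ofReal_l2norm_sq, Matrix.star_mulVec, (cyclicProj_isHermitian k).eq,
    Matrix.dotProduct_mulVec, Matrix.vecMul_vecMul, cyclicProj_mul_self,
    ← Matrix.dotProduct_mulVec, cyclicProj_mulVec_prodVec, dotProduct_smul, dotProduct_sum,
    Finset.sum_eq_single 0]
  · rw [star_prodVec_dotProduct, Fin.prod_univ_succ]
    simp [hφ, ← ofReal_l2norm_sq]
  · intro j _ hj
    rw [star_prodVec_dotProduct]
    refine Finset.prod_eq_zero (Finset.mem_univ 0) ?_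
    obtain ⟨l, hl⟩ := Fin.exists_succ_eq.2 (show (0 : Fin (k + 1)) - j ≠ 0 by simpa using hj)
    rw [← hl]
    simpa using hv
  · simp

/-- On `v ⊗ φ^{⊗k}`, the reflection about the cyclically invariant vectors is close to the
reflection about `φ` on the first factor. -/
theorem l2norm_cyclic_reflection_sub_le {k : ℕ} {φ : H → ℂ} (hφ : star φ ⬝ᵥ φ = 1) (v : H → ℂ) :
    l2norm ((1 - (2 : ℂ) • cyclicProj H k).mulVec (prodVec (Fin.cons v fun _ => φ)) -
      prodVec (Fin.cons ((1 - (2 : ℂ) • Matrix.vecMulVec φ (star φ)).mulVec v) fun _ => φ)) ^ 2 ≤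
      4 / (k + 1) * l2norm v ^ 2 := by
  set a := star φ ⬝ᵥ v with ha
  have h1 : (1 - (2 : ℂ) • Matrix.vecMulVec φ (star φ)).mulVec v = v - (2 * a) • φ := by
    ext h
    simp [Matrix.sub_mulVec, Matrix.smul_mulVec, Matrix.vecMulVec_mulVec, ← ha]
    ring
  -- On the part of `v` along `φ` both reflections agree, since `φ^{⊗(k+1)}` is cyclically
  -- invariant. Only the part orthogonal to `φ` contributes an error.
  have h2 : (1 - (2 : ℂ) • cyclicProj H k).mulVec (prodVec (Fin.cons v fun _ => φ)) -
      prodVec (Fin.cons (v - (2 * a) • φ) fun _ => φ) =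
      (-2 : ℂ) • (cyclicProj H k).mulVec (prodVec (Fin.cons (v - a • φ) fun _ => φ)) := by
    simp only [prodVec_cons_sub, prodVec_cons_smul, Matrix.sub_mulVec, Matrix.smul_mulVec,
      Matrix.one_mulVec, Matrix.mulVec_sub, Matrix.mulVec_smul, cyclicProj_mulVec_cons_same]
    module
  have h3 : star (v - a • φ) ⬝ᵥ φ = 0 := by
    simp only [star_sub, star_smul, sub_dotProduct, smul_dotProduct, hφ]
    rw [ha, ← Matrix.star_dotProduct]
    simp
  have h4 : l2norm (v - a • φ) ^ 2 ≤ l2norm v ^ 2 := by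
    have h5 : l2norm v ^ 2 = l2norm (v - a • φ) ^ 2 + ‖a‖ ^ 2 := by
      have h6 : star φ ⬝ᵥ (v - a • φ) = 0 := by
        simp [dotProduct_sub, dotProduct_smul, hφ, ← ha]
      have h7 : v = (v - a • φ) + a • φ := by simp
      rw [← Complex.ofReal_inj, Complex.ofReal_add, ofReal_l2norm_sq, ofReal_l2norm_sq]
      conv_lhs => rw [h7]
      generalize v - a • φ = u at h3 h6
      simp [star_add, star_smul, add_dotProduct, dotProduct_add, dotProduct_smul, smul_dotProduct,
        h3, h6, hφ, ← Complex.conj_mul', mul_comm]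
    rw [h5]
    exact le_add_of_nonneg_right (sq_nonneg _)
  have h6 : ∀ u : (Fin (k + 1) → H) → ℂ, l2norm ((-2 : ℂ) • u) ^ 2 = 4 * l2norm u ^ 2 := by
    intro u
    simp only [l2norm_sq, Finset.mul_sum]
    refine Finset.sum_congr rfl fun i _ => ?_
    simp [mul_pow]
    norm_num
  rw [h1, h2, h6, l2norm_cyclicProj_cons hφ h3, ← mul_assoc, ← div_eq_mul_inv]
  gcongr

end Cyclic

theorem l2norm_sq_tensorVec {H : Type} [Fintype H] {φ : H → ℂ} (hφ : star φ ⬝ᵥ φ = 1) (k : ℕ) :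
    l2norm (tensorVec k φ) ^ 2 = 1 := by
  have h := star_prodVec_dotProduct (fun _ : Fin k => φ) fun _ => φ
  rw [← Complex.ofReal_inj, ofReal_l2norm_sq]
  refine h.trans ?_
  simp [hφ]

theorem one_kronecker_mulVec {L ι : Type} [Fintype L] [DecidableEq L] [Fintype ι]
    (N : Op ι) (u : L × ι → ℂ) (l : L) (x : ι) :
    ((1 : Op L) ⊗ₖ N).mulVec u (l, x) = N.mulVec (fun y => u (l, y)) x := by
  simp [Matrix.mulVec, dotProduct, Fintype.sum_prod_type, Matrix.one_apply]

section Slices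

variable {H K L : Type} [Fintype H] [DecidableEq H] [Fintype K] [Fintype L] [DecidableEq L]

/-- The vector `w ⊗ φ^{⊗k}`. -/
def withCopies (k : ℕ) (φ : H → ℂ) (w : K → ℂ) : K × (Fin k → H) → ℂ :=
  fun p => w p.1 * tensorVec k φ p.2

/-- Reordering of the tensor factors of `K ⊗ H^{⊗k} = (L ⊗ H) ⊗ H^{⊗k} = L ⊗ H^{⊗(k+1)}`. -/
def consEquiv (k : ℕ) (f : K ≃ L × H) : K × (Fin k → H) ≃ L × (Fin (k + 1) → H) :=
  (f.prodCongr (Equiv.refl _)).trans <| (Equiv.prodAssoc _ _ _).trans <|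
    (Equiv.refl L).prodCongr (Fin.consEquiv fun _ => H)

/-- The reflection `1 - 2 |φ⟩⟨φ|` of the factor `H` of `K = L ⊗ H`. -/
noncomputable def reflectionOp (f : K ≃ L × H) (φ : H → ℂ) : Op K :=
  ((1 : Op L) ⊗ₖ (1 - (2 : ℂ) • Matrix.vecMulVec φ (star φ))).submatrix f f

/-- The reflection about the cyclically invariant vectors in the factors `H^{⊗(k+1)}` of
`K ⊗ H^{⊗k} = L ⊗ H^{⊗(k+1)}`. -/
noncomputable def cyclicReflectionOp (k : ℕ) (f : K ≃ L × H) : Op (K × (Fin k → H)) :=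
  ((1 : Op L) ⊗ₖ (1 - (2 : ℂ) • cyclicProj H k)).submatrix (consEquiv k f) (consEquiv k f)

theorem cyclicReflectionOp_conjTranspose_mul_self [DecidableEq K] (k : ℕ) (f : K ≃ L × H) :
    (cyclicReflectionOp k f).conjTranspose * cyclicReflectionOp k f = 1 := by
  rw [cyclicReflectionOp, Matrix.conjTranspose_submatrix, Matrix.conjTranspose_kronecker,
    reflection_isHermitian (cyclicProj_isHermitian k), Matrix.submatrix_mul_equiv,
    ← Matrix.mul_kronecker_mul, reflection_mul_self (cyclicProj_mul_self k)]
  simp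

/-- Both operators act trivially on `L`, so the squared errors of the slices `w (l, ·)` add up, and
entanglement with the rest of the register costs nothing. -/
theorem l2norm_cyclicReflectionOp_sub_le {k : ℕ} (f : K ≃ L × H) {φ : H → ℂ}
    (hφ : star φ ⬝ᵥ φ = 1) (w : K → ℂ) :
    l2norm ((cyclicReflectionOp k f).mulVec (withCopies k φ w) -
      withCopies k φ ((reflectionOp f φ).mulVec w)) ≤ 2 / √(k + 1) * l2norm w := by
  have hk : (0 : ℝ) ≤ k + 1 := by positivity
  refine le_of_sq_le_sq ?_ (mul_nonneg (by positivity) (l2norm_nonneg _))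
  have h0 : ∀ (w : K → ℂ) l x, withCopies k φ w ((consEquiv k f).symm (l, x)) =
      prodVec (Fin.cons (fun h => w (f.symm (l, h))) fun _ => φ) x := by
    intro w l x
    simp only [prodVec, Fin.prod_univ_succ]
    rfl
  set s : L → H → ℂ := fun l h => w (f.symm (l, h)) with hs
  have h1 : ∀ l x, (cyclicReflectionOp k f).mulVec (withCopies k φ w)
      ((consEquiv k f).symm (l, x)) =
      (1 - (2 : ℂ) • cyclicProj H k).mulVec (prodVec (Fin.cons (s l) fun _ => φ)) x := by
    intro l x
    rw [cyclicReflectionOp, Matrix.submatrix_mulVec_equiv, Function.comp_apply,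
      Equiv.apply_symm_apply, one_kronecker_mulVec]
    congr 1
    funext y
    exact h0 w l y
  have h2 : ∀ l x, withCopies k φ ((reflectionOp f φ).mulVec w) ((consEquiv k f).symm (l, x)) =
      prodVec (Fin.cons ((1 - (2 : ℂ) • Matrix.vecMulVec φ (star φ)).mulVec (s l))
        fun _ => φ) x := by
    intro l x
    rw [h0]
    congr 2
    funext h
    rw [reflectionOp, Matrix.submatrix_mulVec_equiv, Function.comp_apply,
      Equiv.apply_symm_apply, one_kronecker_mulVec]
    rfl
  rw [mul_pow, div_pow, Real.sq_sqrt hk, l2norm_sq, ← Equiv.sum_comp (consEquiv k f).symm,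
    Fintype.sum_prod_type, l2norm_sq w, ← Equiv.sum_comp f.symm, Fintype.sum_prod_type,
    Finset.mul_sum]
  refine Finset.sum_le_sum fun l _ => ?_
  have h3 := l2norm_cyclic_reflection_sub_le (k := k) hφ (s l)
  rw [l2norm_sq, l2norm_sq] at h3
  simp only [Pi.sub_apply, h1, h2]
  norm_num
  exact h3

end Slices

theorem l2norm_withCopies {H K : Type} [Fintype H] [Fintype K] {k : ℕ} {φ : H → ℂ}
    (hφ : star φ ⬝ᵥ φ = 1) (w : K → ℂ) :
    l2norm (withCopies k φ w) = l2norm w := by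
  rw [← sq_eq_sq₀ (l2norm_nonneg _) (l2norm_nonneg _), ← mul_one (l2norm w ^ 2),
    ← l2norm_sq_tensorVec hφ k]
  simp only [l2norm_sq, Fintype.sum_prod_type, Finset.sum_mul_sum, withCopies, norm_mul, mul_pow]

/-! ### Simulating a circuit of reflections and fixed gates -/

section Simulation

theorem withCopies_mulVec {H K : Type} [Fintype H] [DecidableEq H] [Fintype K] (k : ℕ)
    (φ : H → ℂ) (B : Op K) (w : K → ℂ) :
    (B ⊗ₖ (1 : Op (Fin k → H))).mulVec (withCopies k φ w) = withCopies k φ (B.mulVec w) := by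
  ext ⟨p, m⟩
  simp [Matrix.mulVec, dotProduct, Fintype.sum_prod_type, withCopies, Matrix.one_apply,
    Finset.sum_mul, mul_assoc]

theorem reflectionOp_conjTranspose {H K L : Type} [Finite H] [DecidableEq H]
    [DecidableEq L] (f : K ≃ L × H) (φ : H → ℂ) :
    (reflectionOp f φ).conjTranspose = reflectionOp f φ := by
  have h : (Matrix.vecMulVec φ (star φ)).IsHermitian :=
    (Matrix.posSemidef_vecMulVec_self_star φ).1
  rw [reflectionOp, Matrix.conjTranspose_submatrix, Matrix.conjTranspose_kronecker,
    reflection_isHermitian h]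
  simp

variable {H K L : Type} [Fintype H] [DecidableEq H] [Fintype K] [DecidableEq K] [Fintype L]
  [DecidableEq L]

theorem kronecker_one_conjTranspose_mul_self {B : Op K} (hB : B.conjTranspose * B = 1) :
    (B ⊗ₖ (1 : Op L)).conjTranspose * (B ⊗ₖ (1 : Op L)) = 1 := by
  rw [Matrix.conjTranspose_kronecker, ← Matrix.mul_kronecker_mul, hB]
  simp

theorem conjTranspose_mul_self_mul {M N : Op K} (hM : M.conjTranspose * M = 1)
    (hN : N.conjTranspose * N = 1) : (M * N).conjTranspose * (M * N) = 1 := by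
  rw [Matrix.conjTranspose_mul, Matrix.mul_assoc, ← Matrix.mul_assoc _ M, hM, Matrix.one_mul, hN]

theorem l2norm_gate_sub_le {k : ℕ} {φ : H → ℂ} {B : Op K} (hB : B.conjTranspose * B = 1)
    {u : K × (Fin k → H) → ℂ} {w : K → ℂ} {δ : ℝ} (h : l2norm (u - withCopies k φ w) ≤ δ) :
    l2norm ((B ⊗ₖ (1 : Op (Fin k → H))).mulVec u - withCopies k φ (B.mulVec w)) ≤ δ := by
  rw [← withCopies_mulVec, ← Matrix.mulVec_sub,
    l2norm_mulVec (kronecker_one_conjTranspose_mul_self hB)]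
  exact h

theorem l2norm_reflection_sub_le {k : ℕ} (f : K ≃ L × H) {φ : H → ℂ} (hφ : star φ ⬝ᵥ φ = 1)
    {u : K × (Fin k → H) → ℂ} {w : K → ℂ} {δ : ℝ} (h : l2norm (u - withCopies k φ w) ≤ δ)
    (hw : l2norm w = 1) :
    l2norm ((cyclicReflectionOp k f).mulVec u - withCopies k φ ((reflectionOp f φ).mulVec w)) ≤
      δ + 2 / √(k + 1) := by
  have h1 := l2norm_cyclicReflectionOp_sub_le (k := k) f hφ w
  rw [hw, mul_one] at h1
  have h2 : l2norm ((cyclicReflectionOp k f).mulVec (u - withCopies k φ w)) ≤ δ := by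
    rwa [l2norm_mulVec (cyclicReflectionOp_conjTranspose_mul_self k f)]
  have h3 := l2norm_add_le ((cyclicReflectionOp k f).mulVec (u - withCopies k φ w))
    ((cyclicReflectionOp k f).mulVec (withCopies k φ w) -
      withCopies k φ ((reflectionOp f φ).mulVec w))
  rw [Matrix.mulVec_sub, sub_add_sub_cancel] at h3
  rw [Matrix.mulVec_sub] at h2
  linarith

theorem reflectionOp_mul_self (f : K ≃ L × H) {φ : H → ℂ} (hφ : star φ ⬝ᵥ φ = 1) :
    reflectionOp f φ * reflectionOp f φ = 1 := by
  have h : Matrix.vecMulVec φ (star φ) * Matrix.vecMulVec φ (star φ) =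
      Matrix.vecMulVec φ (star φ) := by
    rw [Matrix.vecMulVec_mul_vecMulVec, hφ]; simp
  rw [reflectionOp, Matrix.submatrix_mul_equiv, ← Matrix.mul_kronecker_mul, reflection_mul_self h]
  simp

variable {σ : Type}

/-- The circuit in which the query `s` is `R (gate s) R`, with `R` the reflection about `φ`. -/
noncomputable def reflectionCircuit (f : K ≃ L × H) (φ : H → ℂ) (gate : σ → Op K)
    (steps : List (σ × Matrix.unitaryGroup K ℂ)) (M : Op K) : Op K :=
  steps.foldl (fun M s => (s.2 : Op K) * (reflectionOp f φ * gate s.1 * reflectionOp f φ) * M) M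

/-- The simulation of `reflectionCircuit` with `k` copies of `φ`. -/
noncomputable def cyclicCircuit (k : ℕ) (f : K ≃ L × H) (gate : σ → Op K)
    (steps : List (σ × Matrix.unitaryGroup K ℂ)) (M : Op (K × (Fin k → H))) :
    Op (K × (Fin k → H)) :=
  steps.foldl (fun M s => ((s.2 : Op K) ⊗ₖ (1 : Op (Fin k → H))) * (cyclicReflectionOp k f *
    (gate s.1 ⊗ₖ (1 : Op (Fin k → H))) * cyclicReflectionOp k f) * M) M

theorem cyclicCircuit_conjTranspose_mul_self {k : ℕ} (f : K ≃ L × H) {gate : σ → Op K}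
    (hgate : ∀ s, (gate s).conjTranspose * gate s = 1)
    (steps : List (σ × Matrix.unitaryGroup K ℂ)) {M : Op (K × (Fin k → H))}
    (hM : M.conjTranspose * M = 1) :
    (cyclicCircuit k f gate steps M).conjTranspose * cyclicCircuit k f gate steps M = 1 := by
  induction steps generalizing M with
  | nil => exact hM
  | cons s steps ih =>
    have hC := cyclicReflectionOp_conjTranspose_mul_self k f
    refine ih (conjTranspose_mul_self_mul (conjTranspose_mul_self_mul
      (kronecker_one_conjTranspose_mul_self (Matrix.mem_unitaryGroup_iff'.1 s.2.2)) ?_) hM)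
    exact conjTranspose_mul_self_mul (conjTranspose_mul_self_mul hC
      (kronecker_one_conjTranspose_mul_self (hgate s.1))) hC

/-- Unitaries preserve the error made so far, so errors only add: each query has two reflections,
costing `2 / √(k + 1)` apiece. The comparison state always carries intact copies, which is why they
may be reused. -/
theorem l2norm_cyclicCircuit_sub_le {k : ℕ} (f : K ≃ L × H) {φ : H → ℂ} (hφ : star φ ⬝ᵥ φ = 1)
    {gate : σ → Op K} (hgate : ∀ s, (gate s).conjTranspose * gate s = 1)
    (steps : List (σ × Matrix.unitaryGroup K ℂ)) {w : K → ℂ} (hw : l2norm w = 1)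
    {M : Op K} {N : Op (K × (Fin k → H))} (hM : M.conjTranspose * M = 1) {δ : ℝ}
    (hδ : l2norm (N.mulVec (withCopies k φ w) - withCopies k φ (M.mulVec w)) ≤ δ) :
    l2norm ((cyclicCircuit k f gate steps N).mulVec (withCopies k φ w) -
      withCopies k φ ((reflectionCircuit f φ gate steps M).mulVec w)) ≤
      δ + steps.length * (4 / √(k + 1)) := by
  induction steps generalizing M N δ with
  | nil => simpa [cyclicCircuit, reflectionCircuit] using hδ
  | cons s steps ih =>
    have hR : (reflectionOp f φ).conjTranspose * reflectionOp f φ = 1 := by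
      rw [reflectionOp_conjTranspose, reflectionOp_mul_self f hφ]
    have hs := Matrix.mem_unitaryGroup_iff'.1 s.2.2
    have h0 : l2norm (M.mulVec w) = 1 := by rw [l2norm_mulVec hM, hw]
    have h1 := l2norm_reflection_sub_le f hφ hδ h0
    have h2 := l2norm_gate_sub_le (hgate s.1) h1
    have h3 := l2norm_reflection_sub_le f hφ h2
      (by rw [l2norm_mulVec (hgate s.1), l2norm_mulVec hR, h0])
    have h4 := l2norm_gate_sub_le hs h3
    have h5 := ih (M := (s.2 : Op K) * (reflectionOp f φ * gate s.1 * reflectionOp f φ) * M)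
      (N := ((s.2 : Op K) ⊗ₖ (1 : Op (Fin k → H))) * (cyclicReflectionOp k f *
        (gate s.1 ⊗ₖ (1 : Op (Fin k → H))) * cyclicReflectionOp k f) * N)
      (conjTranspose_mul_self_mul (conjTranspose_mul_self_mul hs
        (conjTranspose_mul_self_mul (conjTranspose_mul_self_mul hR (hgate s.1)) hR)) hM)
      (by simpa only [Matrix.mulVec_mulVec, Matrix.mul_assoc] using h4)
    refine h5.trans (le_of_eq ?_)
    simp only [List.length_cons]
    push_cast
    ring

end Simulation

/-! ### Measurements from circuits -/

section Povm

variable {Y E : Type} [Fintype Y] [DecidableEq Y] [Fintype E] [DecidableEq E]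

/-- Running the isometry `W` on `|p⟩ ⊗ χ` and measuring the first qubit is a two-outcome
measurement of `χ`. -/
theorem exists_povm_of_circuit {W : Op ((Fin 2 × Y) × E)} (hW : W.conjTranspose * W = 1)
    (p : Fin 2 × Y) :
    ∃ M : Op E, M.PosSemidef ∧ (1 - M).PosSemidef ∧ ∀ χ : E → ℂ,
      (M * Matrix.vecMulVec χ (star χ)).trace.re =
        l2norm (fun q : Y × E =>
          W.mulVec (fun r => (Pi.single p 1 : Fin 2 × Y → ℂ) r.1 * χ r.2) ((0, q.1), q.2)) ^ 2 := by
  set F : Fin 2 → Matrix (Y × E) E ℂ :=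
    fun b => Matrix.of fun q m => W ((b, q.1), q.2) (p, m) with hF
  have hsum : (F 0).conjTranspose * F 0 + (F 1).conjTranspose * F 1 = 1 := by
    ext m m'
    have h := congrFun (congrFun hW (p, m)) (p, m')
    simp only [Matrix.mul_apply, Fintype.sum_prod_type, Fin.sum_univ_two,
      Matrix.conjTranspose_apply, Matrix.one_apply, Prod.mk.injEq, true_and] at h
    simpa only [Matrix.add_apply, Matrix.mul_apply, Fintype.sum_prod_type,
      Matrix.conjTranspose_apply, Matrix.one_apply, hF, Matrix.of_apply] using h
  refine ⟨(F 0).conjTranspose * F 0, Matrix.posSemidef_conjTranspose_mul_self _, ?_, fun χ => ?_⟩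
  · rw [← hsum, add_sub_cancel_left]
    exact Matrix.posSemidef_conjTranspose_mul_self _
  · have h1 : (fun q : Y × E =>
        W.mulVec (fun r => (Pi.single p 1 : Fin 2 × Y → ℂ) r.1 * χ r.2) ((0, q.1), q.2)) =
        (F 0).mulVec χ := by
      ext q
      simp only [Matrix.mulVec, dotProduct, hF, Matrix.of_apply]
      rw [Fintype.sum_prod_type, Finset.sum_eq_single p]
      · simp
      · intro r _ hr; simp [hr]
      · simp
    rw [h1, ← Complex.ofReal_re (l2norm _ ^ 2), ofReal_l2norm_sq, Matrix.mul_vecMulVec,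
      Matrix.trace_vecMulVec, Matrix.star_mulVec, ← Matrix.mulVec_mulVec, dotProduct_comm,
      Matrix.dotProduct_mulVec, Matrix.dotProduct_mulVec]

theorem l2norm_restrict_le {Y E : Type} [Fintype Y] [Fintype E] (v : (Fin 2 × Y) × E → ℂ) :
    l2norm (fun q : Y × E => v ((0, q.1), q.2)) ≤ l2norm v := by
  refine le_of_sq_le_sq ?_ (l2norm_nonneg _)
  rw [l2norm_sq, l2norm_sq]
  simp only [Fintype.sum_prod_type, Fin.sum_univ_two]
  exact le_add_of_nonneg_right (by positivity)

/-- Restriction is a contraction, and in `a² - b² = (a + b) (a - b)` the first factor is at most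
`2`. -/
theorem abs_l2norm_restrict_sq_sub_le {Y E : Type} [Fintype Y] [Fintype E]
    {u v : (Fin 2 × Y) × E → ℂ} (hu : l2norm u = 1)
    (hv : l2norm v = 1) :
    |l2norm (fun q : Y × E => u ((0, q.1), q.2)) ^ 2 -
      l2norm (fun q : Y × E => v ((0, q.1), q.2)) ^ 2| ≤ 2 * l2norm (u - v) := by
  have h1 := l2norm_restrict_le u
  have h2 := l2norm_restrict_le v
  have h3 := l2norm_restrict_le (u - v)
  set a := fun q : Y × E => u ((0, q.1), q.2)
  set b := fun q : Y × E => v ((0, q.1), q.2)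
  have h4 : |l2norm a - l2norm b| ≤ l2norm (a - b) :=
    abs_norm_sub_norm_le (WithLp.toLp 2 a : EuclideanSpace ℂ (Y × E)) (WithLp.toLp 2 b)
  have h5 : l2norm (a - b) ≤ l2norm (u - v) := h3
  rw [sq_sub_sq, abs_mul, abs_of_nonneg (add_nonneg (l2norm_nonneg a) (l2norm_nonneg b))]
  have h6 := l2norm_nonneg a
  have h7 := l2norm_nonneg b
  exact mul_le_mul (by linarith) (h4.trans h5) (abs_nonneg _) (by norm_num)

end Povm

/-! ### A block-encoding made of two reflections -/

/-- The factor `H` of `X ⊗ K`, where `K = L ⊗ H`. -/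
def liftEquiv (X : Type) {K L H : Type} (f : K ≃ L × H) : X × K ≃ (X × L) × H :=
  ((Equiv.refl X).prodCongr f).trans (Equiv.prodAssoc X L H).symm

theorem one_kronecker_reflectionOp {X K L H : Type} [DecidableEq X] [DecidableEq L]
    [DecidableEq H] (f : K ≃ L × H) (φ : H → ℂ) :
    (1 : Op X) ⊗ₖ reflectionOp f φ = reflectionOp (liftEquiv X f) φ := by
  ext ⟨x, p⟩ ⟨y, q⟩
  change (1 : Op X) x y * ((1 : Op L) (f p).1 (f q).1 * _) =
    (1 : Op (X × L)) (x, (f p).1) (y, (f q).1) * _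
  rw [← mul_assoc, ← Matrix.one_kronecker_one]
  rfl

theorem exists_ancillaEquiv (n : ℕ) :
    ∃ e : Qubits (2 * n + 2) ≃ Fin 2 × Flagged (Qubits n), e 0 = 0 := by
  have h : Fintype.card (Qubits (2 * n + 2)) = Fintype.card (Fin 2 × Flagged (Qubits n)) := by
    simp only [Fintype.card_prod, Fintype.card_fun, Fintype.card_fin]
    ring
  let e := Fintype.equivOfCardEq h
  -- The swap makes the all-zero ancilla label correspond to `|⊥⟩` with the rotation qubit at `0`.
  exact ⟨e.trans (Equiv.swap (e 0) 0), by simp⟩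

/-- A rotation with upper left entry `1 / 2`. -/
noncomputable def halfRotation : Op (Fin 2) :=
  !![1 / 2, -((√3 / 2 : ℝ) : ℂ); ((√3 / 2 : ℝ) : ℂ), 1 / 2]

theorem halfRotation_mem : halfRotation.conjTranspose * halfRotation = 1 := by
  have h : ((√3 : ℝ) : ℂ) * ((√3 : ℝ) : ℂ) = 3 := by
    rw [← Complex.ofReal_mul, Real.mul_self_sqrt (by norm_num)]; simp
  ext i j
  fin_cases i <;> fin_cases j <;>
    simp only [halfRotation, Matrix.mul_apply, Fin.sum_univ_two, Matrix.conjTranspose_apply] <;>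
    simp
  · linear_combination h / 4
  · ring
  · ring
  · linear_combination h / 4

/-- The exchange of the system of `Flagged A` with another copy of the system. -/
def systemSwap (A : Type) : Flagged A × A ≃ Flagged A × A where
  toFun p := ((p.1.1, (p.2, p.1.2.2)), p.1.2.1)
  invFun p := ((p.1.1, (p.2, p.1.2.2)), p.1.2.1)
  left_inv _ := rfl
  right_inv _ := rfl

section BlockEncoding

variable {a n : ℕ} (e : Qubits a ≃ Fin 2 × Flagged (Qubits n))

/-- The part of the oracle's register that carries the vector `purifVec Ψ`. -/
def oracleEquiv : Qubits a × Qubits n ≃ (Fin 2 × Qubits n) × Flagged (Qubits n) where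
  toFun p := (((e p.1).1, p.2), (e p.1).2)
  invFun q := (e.symm (q.1.1, q.2), q.1.2)
  left_inv p := by simp
  right_inv q := by simp

/-- The gate between the two reflections: a rotation and a swap. -/
noncomputable def swapGate : Op (Qubits a × Qubits n) :=
  (halfRotation ⊗ₖ (1 : Op (Flagged (Qubits n) × Qubits n)).submatrix
    (systemSwap (Qubits n)) id).submatrix
    (fun p => ((e p.1).1, ((e p.1).2, p.2))) (fun p => ((e p.1).1, ((e p.1).2, p.2)))

theorem swapGate_mem : swapGate e ∈ Matrix.unitaryGroup (Qubits a × Qubits n) ℂ := by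
  let g : Qubits a × Qubits n ≃ Fin 2 × (Flagged (Qubits n) × Qubits n) :=
    (e.prodCongr (Equiv.refl _)).trans (Equiv.prodAssoc _ _ _)
  have h : swapGate e = (halfRotation ⊗ₖ (1 : Op (Flagged (Qubits n) × Qubits n)).submatrix
    (systemSwap (Qubits n)) id).submatrix g g := rfl
  rw [Matrix.mem_unitaryGroup_iff', h, Matrix.star_eq_conjTranspose,
    Matrix.conjTranspose_submatrix, Matrix.submatrix_mul_equiv, Matrix.conjTranspose_kronecker,
    ← Matrix.mul_kronecker_mul, halfRotation_mem, Matrix.conjTranspose_submatrix,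
    Matrix.submatrix_mul_equiv]
  simp

theorem purifVec_zero (Ψ : Op (Qubits n)) : purifVec Ψ 0 = ((√2 : ℝ) : ℂ)⁻¹ := by
  simp [purifVec]

theorem star_purifVec_dotProduct {Ψ : Op (Qubits n)} (hΨ : (Ψ * Ψ.conjTranspose).trace = 1) :
    star (purifVec Ψ) ⬝ᵥ purifVec Ψ = 1 := by
  have h0 : ∑ x, ∑ y, Ψ x y * star (Ψ x y) = 1 := by
    simpa [Matrix.trace, Matrix.mul_apply] using hΨ
  have h1 : ∀ h, (star (purifVec Ψ)) h * purifVec Ψ h =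
      (1 / 2) * if h.1 = 0 then (if h.2 = 0 then 1 else 0)
        else Ψ h.2.1 h.2.2 * star (Ψ h.2.1 h.2.2) := by
    intro h
    rw [← inv_sqrt_two_mul_self]
    simp only [Pi.star_apply, purifVec]
    split_ifs
    all_goals simp
    ring
  simp only [dotProduct, h1]
  rw [Fintype.sum_prod_type, Fin.sum_univ_two, ← Finset.mul_sum, ← Finset.mul_sum]
  simp only [if_true, Fin.isValue, one_ne_zero, if_false, Finset.sum_ite_eq', Finset.mem_univ]
  rw [Fintype.sum_prod_type, h0]
  norm_num

/-- This is `R |⊥⟩ = |⊥⟩ - (|⊥⟩ - |Ψ⟩) = |Ψ⟩`: the reflection prepares the purification from the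
zero state. -/
theorem reflection_purifVec_zero (Ψ : Op (Qubits n)) (h : Flagged (Qubits n)) :
    (1 - (2 : ℂ) • Matrix.vecMulVec (purifVec Ψ) (star (purifVec Ψ))) h 0 =
      if h.1 = 0 then 0 else Ψ h.2.1 h.2.2 := by
  have h2 := inv_sqrt_two_mul_self
  simp only [Matrix.sub_apply, Matrix.one_apply, Matrix.smul_apply, Matrix.vecMulVec_apply,
    Pi.star_apply, purifVec_zero, smul_eq_mul]
  obtain ⟨f, c⟩ := h
  have h3 : star (((√2 : ℝ) : ℂ)⁻¹) = ((√2 : ℝ) : ℂ)⁻¹ := by simp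
  rw [h3]
  by_cases hf : f = 0 <;> by_cases hc : c = 0 <;>
    simp only [purifVec, hf, hc, Prod.ext_iff, Prod.fst_zero, Prod.snd_zero, true_and, and_true,
      and_self, if_true, if_false]
  · linear_combination -2 * h2
  · ring
  · linear_combination 2 * Ψ (0 : Qubits n × Qubits n).1 (0 : Qubits n × Qubits n).2 * h2
  · linear_combination 2 * Ψ c.1 c.2 * h2

/-- The unitary `R C R`, with `R` the reflection about `purifVec Ψ`. -/
noncomputable def oracleOp (Ψ : Op (Qubits n)) : Op (Qubits a × Qubits n) :=
  reflectionOp (oracleEquiv e) (purifVec Ψ) * swapGate e *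
    reflectionOp (oracleEquiv e) (purifVec Ψ)

theorem oracleOp_mem {Ψ : Op (Qubits n)} (hΨ : (Ψ * Ψ.conjTranspose).trace = 1) :
    oracleOp e Ψ ∈ Matrix.unitaryGroup (Qubits a × Qubits n) ℂ := by
  have hR : reflectionOp (oracleEquiv e) (purifVec Ψ) ∈
      Matrix.unitaryGroup (Qubits a × Qubits n) ℂ := by
    rw [Matrix.mem_unitaryGroup_iff', Matrix.star_eq_conjTranspose, reflectionOp_conjTranspose,
      reflectionOp_mul_self _ (star_purifVec_dotProduct hΨ)]
  exact mul_mem (mul_mem hR (swapGate_mem e)) hR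

/-- Between the states `|Ψ⟩|x⟩` and `|Ψ⟩|y⟩` prepared by the two reflections, the swap has matrix
element `∑ b, Ψ x b * conj (Ψ y b)`. The rotation supplies the factor `1 / 2`. -/
theorem oracleOp_block (he : e 0 = 0) (Ψ : Op (Qubits n)) (x y : Qubits n) :
    oracleOp e Ψ (0, x) (0, y) = 1 / 2 * (Ψ * Ψ.conjTranspose) x y := by
  set r := 1 - (2 : ℂ) • Matrix.vecMulVec (purifVec Ψ) (star (purifVec Ψ)) with hr
  have hrc : ∀ h, r 0 h = star (r h 0) := by
    intro h
    have h1 : r.conjTranspose = r :=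
      reflection_isHermitian (Matrix.posSemidef_vecMulVec_self_star (purifVec Ψ)).1
    conv_lhs => rw [← h1]
    rfl
  have hr0 := reflection_purifVec_zero Ψ
  rw [← hr] at hr0
  let g := (oracleEquiv e).symm
  have h1 : ∀ c z h, reflectionOp (oracleEquiv e) (purifVec Ψ) (0, x) (g ((c, z), h)) =
      if c = 0 ∧ z = x then r 0 h else 0 := by
    intro c z h
    simp [reflectionOp, g, oracleEquiv, he, Matrix.one_apply, ← hr, eq_comm]
  have h2 : ∀ c z h, reflectionOp (oracleEquiv e) (purifVec Ψ) (g ((c, z), h)) (0, y) =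
      if c = 0 ∧ z = y then r h 0 else 0 := by
    intro c z h
    simp [reflectionOp, g, oracleEquiv, he, Matrix.one_apply, ← hr]
  have h3 : ∀ z h z' h', swapGate e (g ((0, z), h)) (g ((0, z'), h')) =
      1 / 2 * if (h.1, (z, h.2.2)) = h' ∧ h.2.1 = z' then 1 else 0 := by
    intro z h z' h'
    simp [swapGate, g, oracleEquiv, systemSwap, halfRotation, Matrix.one_apply]
  have hsum : ∀ F : Qubits a × Qubits n → ℂ,
      ∑ p, F p = ∑ c, ∑ z, ∑ h, F (g ((c, z), h)) := by
    intro F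
    rw [← Equiv.sum_comp g, Fintype.sum_prod_type, Fintype.sum_prod_type]
  calc oracleOp e Ψ (0, x) (0, y)
      = ∑ h', (∑ h, r 0 h * swapGate e (g ((0, x), h)) (g ((0, y), h'))) * r h' 0 := by
        simp only [oracleOp, Matrix.mul_apply, hsum, h1, h2, ite_and, ite_mul, zero_mul, mul_ite,
          mul_zero, Finset.sum_ite_irrel, Finset.sum_const_zero, Finset.sum_ite_eq',
          Finset.mem_univ, if_true]
    _ = ∑ h, ∑ h', if (h.1, (x, h.2.2)) = h' then
          (if h.2.1 = y then 1 / 2 * (star (r h 0) * r h' 0) else 0) else 0 := by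
        simp only [h3, hrc, Finset.sum_mul]
        rw [Finset.sum_comm]
        refine Finset.sum_congr rfl fun h _ => Finset.sum_congr rfl fun h' _ => ?_
        rw [ite_and]
        split_ifs <;> ring
    _ = 1 / 2 * (Ψ * Ψ.conjTranspose) x y := by
        simp only [Finset.sum_ite_eq, Finset.mem_univ, if_true, hr0]
        rw [Fintype.sum_prod_type, Fin.sum_univ_two]
        simp [Fintype.sum_prod_type, Finset.sum_ite_irrel, Matrix.mul_apply, Finset.mul_sum,
          mul_comm]

theorem isBlockEncoding_oracleOp (he : e 0 = 0) {Ψ : Op (Qubits n)}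
    (hΨ : (Ψ * Ψ.conjTranspose).trace = 1) :
    IsBlockEncoding ⟨oracleOp e Ψ, oracleOp_mem e hΨ⟩ ((1 / 2 : ℂ) • (Ψ * Ψ.conjTranspose)) := by
  ext x y
  exact oracleOp_block e he Ψ x y

/-- The part of the whole register that carries the vector `purifVec Ψ`. -/
def registerEquiv (w : ℕ) : Register w a n ≃
    (Fin 2 × (Qubits w × (Fin 2 × Qubits n))) × Flagged (Qubits n) :=
  liftEquiv (Fin 2) (liftEquiv (Qubits w) (oracleEquiv e))

/-- When the control is off, the two reflections cancel because `R² = 1`. Hence the reflections need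
no control. -/
theorem queryOp_oracleOp (w : ℕ) {Ψ : Op (Qubits n)} (hΨ : (Ψ * Ψ.conjTranspose).trace = 1)
    (s : QueryKind) :
    queryOp w ⟨oracleOp e Ψ, oracleOp_mem e hΨ⟩ s =
      reflectionOp (registerEquiv e w) (purifVec Ψ) * queryOp w ⟨swapGate e, swapGate_mem e⟩ s *
        reflectionOp (registerEquiv e w) (purifVec Ψ) := by
  have hR := reflectionOp_mul_self (oracleEquiv e) (star_purifVec_dotProduct hΨ)
  have hc := reflectionOp_conjTranspose (oracleEquiv e) (purifVec Ψ)
  rw [registerEquiv, ← one_kronecker_reflectionOp, ← one_kronecker_reflectionOp]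
  cases s <;>
    simp only [queryOp, oracleOp, mul_add, add_mul, ← Matrix.mul_kronecker_mul, one_mul, mul_one,
      hR, Matrix.one_kronecker_one, Matrix.conjTranspose_mul, hc, mul_assoc]

theorem queryOp_conjTranspose_mul_self (w : ℕ)
    (U : Matrix.unitaryGroup (Qubits a × Qubits n) ℂ) (s : QueryKind) :
    (queryOp w U s).conjTranspose * queryOp w U s = 1 := by
  have h1 : (U : Op (Qubits a × Qubits n)).conjTranspose * U = 1 :=
    Matrix.mem_unitaryGroup_iff'.1 U.2
  have h2 : (U : Op (Qubits a × Qubits n)) * (U : Op (Qubits a × Qubits n)).conjTranspose = 1 :=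
    Matrix.mem_unitaryGroup_iff.1 U.2
  cases s <;>
    simp [queryOp, Matrix.conjTranspose_kronecker, mul_add, add_mul, ← Matrix.mul_kronecker_mul,
      h1, h2, ← Matrix.add_kronecker, single_add_single]

end BlockEncoding

/-! ### From query algorithms to measurements of copies -/

theorem QueryAlgorithm.circuit_conjTranspose_mul_self {a n : ℕ} (A : QueryAlgorithm a n)
    (U : Matrix.unitaryGroup (Qubits a × Qubits n) ℂ) :
    (A.circuit U).conjTranspose * A.circuit U = 1 := by
  have h : ∀ (steps : List (QueryKind × Matrix.unitaryGroup (Register A.work a n) ℂ))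
      (M : Op (Register A.work a n)), M.conjTranspose * M = 1 →
      (steps.foldl (fun M s => (s.2 : Op (Register A.work a n)) * queryOp A.work U s.1 * M)
        M).conjTranspose * steps.foldl (fun M s =>
          (s.2 : Op (Register A.work a n)) * queryOp A.work U s.1 * M) M = 1 := by
    intro steps
    induction steps with
    | nil => exact fun M hM => hM
    | cons s steps ih =>
      exact fun M hM => ih _ (conjTranspose_mul_self_mul (conjTranspose_mul_self_mul
        (Matrix.mem_unitaryGroup_iff'.1 s.2.2) (queryOp_conjTranspose_mul_self _ _ _)) hM)
  exact h _ _ (Matrix.mem_unitaryGroup_iff'.1 A.init.2)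

/-- A query algorithm can be simulated by a measurement of copies of `purifVec Ψ`. -/
theorem exists_povm_of_queryAlgorithm {n : ℕ} (A : QueryAlgorithm (2 * n + 2) n) (k : ℕ) :
    ∃ M : Op (Fin k → Flagged (Qubits n)), M.PosSemidef ∧ (1 - M).PosSemidef ∧
      ∀ (ρ : DensityOperator n) (Ψ : Op (Qubits n)), Ψ * Ψ.conjTranspose = ρ.mat →
        ∃ U, IsBlockEncoding U ((1 / 2 : ℂ) • ρ.mat) ∧
          |(M * Matrix.vecMulVec (tensorVec k (purifVec Ψ))
            (star (tensorVec k (purifVec Ψ)))).trace.re - A.acceptProb U| ≤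
            8 * A.queries / √(k + 1) := by
  obtain ⟨e, he⟩ := exists_ancillaEquiv n
  set f := registerEquiv e A.work
  set gate := queryOp A.work ⟨swapGate e, swapGate_mem e⟩
  have hgate : ∀ s, (gate s).conjTranspose * gate s = 1 := queryOp_conjTranspose_mul_self _ _
  have hinit : (A.init : Op (Register A.work (2 * n + 2) n)).conjTranspose * A.init = 1 :=
    Matrix.mem_unitaryGroup_iff'.1 A.init.2
  set W := cyclicCircuit k f gate A.steps
    ((A.init : Op (Register A.work (2 * n + 2) n)) ⊗ₖ (1 : Op (Fin k → Flagged (Qubits n))))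
  have hW := cyclicCircuit_conjTranspose_mul_self (k := k) f hgate A.steps
    (kronecker_one_conjTranspose_mul_self hinit)
  obtain ⟨M, hM, hM', hMχ⟩ := exists_povm_of_circuit hW 0
  refine ⟨M, hM, hM', fun ρ Ψ hΨ => ?_⟩
  have htr : (Ψ * Ψ.conjTranspose).trace = 1 := by rw [hΨ, ρ.trace_eq_one]
  refine ⟨⟨oracleOp e Ψ, oracleOp_mem e htr⟩, hΨ ▸ isBlockEncoding_oracleOp e he htr, ?_⟩
  set φ := purifVec Ψ
  have hφ : star φ ⬝ᵥ φ = 1 := star_purifVec_dotProduct htr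
  set w : Register A.work (2 * n + 2) n → ℂ := Pi.single 0 1 with hw
  have hw1 : l2norm w = 1 := by
    rw [← sq_eq_sq₀ (l2norm_nonneg _) zero_le_one, ← Complex.ofReal_inj, ofReal_l2norm_sq, hw]
    simp
  have hcirc : reflectionCircuit f φ gate A.steps A.init =
      A.circuit ⟨oracleOp e Ψ, oracleOp_mem e htr⟩ := by
    simp only [reflectionCircuit, QueryAlgorithm.circuit]
    congr 1
    funext M s
    rw [queryOp_oracleOp e A.work htr]
  -- The initial gate does not touch the copies, so the simulation starts without error.
  have herr := l2norm_cyclicCircuit_sub_le (k := k) f hφ hgate A.steps hw1 hinit (δ := 0)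
    (N := (A.init : Op (Register A.work (2 * n + 2) n)) ⊗ₖ (1 : Op (Fin k → Flagged (Qubits n))))
    (by rw [withCopies_mulVec, sub_self]; simp [l2norm])
  rw [hcirc] at herr
  set U : Matrix.unitaryGroup (Qubits (2 * n + 2) × Qubits n) ℂ :=
    ⟨oracleOp e Ψ, oracleOp_mem e htr⟩
  have hacc : A.acceptProb U = l2norm (fun q : (Qubits A.work × (Qubits (2 * n + 2) × Qubits n)) ×
      (Fin k → Flagged (Qubits n)) =>
      withCopies k φ ((A.circuit U).mulVec w) ((0, q.1), q.2)) ^ 2 := by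
    have h := l2norm_withCopies (k := k) hφ
      (fun x : Qubits A.work × (Qubits (2 * n + 2) × Qubits n) => A.circuit U (0, x) 0)
    rw [QueryAlgorithm.acceptProb, ← l2norm_sq, ← h]
    simp only [hw, Matrix.mulVec_single_one]
    rfl
  have hnorm : l2norm (withCopies k φ ((A.circuit U).mulVec w)) = 1 := by
    rw [l2norm_withCopies hφ, l2norm_mulVec (A.circuit_conjTranspose_mul_self U), hw1]
  have hnorm' : l2norm (W.mulVec (withCopies k φ w)) = 1 := by
    rw [l2norm_mulVec (U := W) (by convert hW), l2norm_withCopies hφ, hw1]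
  rw [hMχ, hacc]
  refine (abs_l2norm_restrict_sq_sub_le hnorm' hnorm).trans ?_
  refine (mul_le_mul_of_nonneg_left herr zero_le_two).trans (le_of_eq ?_)
  rw [QueryAlgorithm.queries]
  ring

/-! ### Combining testers -/

section Testers

variable {n s t : ℕ}

theorem trace_copies (ρ : DensityOperator n) (s : ℕ) : (copies ρ s).trace = 1 := by
  have h : ∑ x : Fin s → Qubits n, ∏ i, ρ.mat (x i) (x i) = ∏ _i : Fin s, ∑ x, ρ.mat x x := by
    rw [Finset.prod_univ_sum, Fintype.piFinset_univ]
  have h1 : ∑ x, ρ.mat x x = 1 := ρ.trace_eq_one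
  rw [h1, Finset.prod_const_one] at h
  exact h

/-- With `D = √ρ^{⊗s}` the trace becomes that of `D† M D`. -/
theorem trace_mul_copies_nonneg {M : Op (Fin s → Qubits n)} (hM : M.PosSemidef)
    (ρ : DensityOperator n) : 0 ≤ (M * copies ρ s).trace := by
  obtain ⟨-, -, X, -, hX, hXX⟩ := ρ.exists_sqrt
  set D := tensorProd fun _ : Fin s => X with hD
  have h : copies ρ s = D * D.conjTranspose := by
    rw [hD, tensorProd_conjTranspose, tensorProd_mul, hX.eq, hXX]
    rfl
  rw [h, ← Matrix.mul_assoc, Matrix.trace_mul_comm, ← Matrix.mul_assoc]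
  exact (hM.conjTranspose_mul_mul_same D).trace_nonneg

theorem SampleTester.ofReal_acceptProb (T : SampleTester n s) (ρ : DensityOperator n) :
    (T.acceptProb ρ : ℂ) = (T.accept * copies ρ s).trace :=
  (Complex.eq_re_of_ofReal_le (r := 0)
    (by simpa using trace_mul_copies_nonneg T.accept_posSemidef ρ)).symm

theorem SampleTester.trace_reject (T : SampleTester n s) (ρ : DensityOperator n) :
    ((1 - T.accept) * copies ρ s).trace = ((1 - T.acceptProb ρ : ℝ) : ℂ) := by
  rw [Matrix.sub_mul, Matrix.one_mul, Matrix.trace_sub, trace_copies, Complex.ofReal_sub,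
    T.ofReal_acceptProb, Complex.ofReal_one]

theorem SampleTester.acceptProb_mem_Icc (T : SampleTester n s) (ρ : DensityOperator n) :
    T.acceptProb ρ ∈ Set.Icc (0 : ℝ) 1 := by
  have h1 := trace_mul_copies_nonneg T.accept_posSemidef ρ
  have h2 := trace_mul_copies_nonneg T.reject_posSemidef ρ
  rw [← T.ofReal_acceptProb, Complex.zero_le_real] at h1
  rw [T.trace_reject, Complex.zero_le_real] at h2
  exact ⟨h1, by linarith⟩

theorem copies_add (ρ : DensityOperator n) (s t : ℕ) :
    copies ρ (s + t) = (copies ρ s ⊗ₖ copies ρ t).submatrix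
      (Fin.appendEquiv s t).symm (Fin.appendEquiv s t).symm := by
  ext x y
  simp only [copies, Matrix.of_apply, Fin.prod_univ_add]
  rfl

/-- Run `T`, then run `T₁` on fresh samples if `T` accepts and `T₀` if it rejects. -/
noncomputable def SampleTester.ite (T : SampleTester n s) (T₁ T₀ : SampleTester n t) :
    SampleTester n (s + t) where
  accept := (T.accept ⊗ₖ T₁.accept + (1 - T.accept) ⊗ₖ T₀.accept).submatrix
    (Fin.appendEquiv s t).symm (Fin.appendEquiv s t).symm
  accept_posSemidef := ((T.accept_posSemidef.kronecker T₁.accept_posSemidef).add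
    (T.reject_posSemidef.kronecker T₀.accept_posSemidef)).submatrix _
  reject_posSemidef := by
    have h : (1 : Op (Fin (s + t) → Qubits n)) -
        (T.accept ⊗ₖ T₁.accept + (1 - T.accept) ⊗ₖ T₀.accept).submatrix
          (Fin.appendEquiv s t).symm (Fin.appendEquiv s t).symm =
        (T.accept ⊗ₖ (1 - T₁.accept) + (1 - T.accept) ⊗ₖ (1 - T₀.accept)).submatrix
          (Fin.appendEquiv s t).symm (Fin.appendEquiv s t).symm := by
      rw [← Matrix.submatrix_one_equiv (Fin.appendEquiv s t).symm, ← Matrix.one_kronecker_one]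
      ext x y
      simp only [Matrix.sub_apply, Matrix.submatrix_apply, Matrix.add_apply,
        Matrix.kroneckerMap_apply]
      ring
    rw [h]
    exact ((T.accept_posSemidef.kronecker T₁.reject_posSemidef).add
      (T.reject_posSemidef.kronecker T₀.reject_posSemidef)).submatrix _

theorem SampleTester.acceptProb_ite (T : SampleTester n s) (T₁ T₀ : SampleTester n t)
    (ρ : DensityOperator n) :
    (T.ite T₁ T₀).acceptProb ρ =
      T.acceptProb ρ * T₁.acceptProb ρ + (1 - T.acceptProb ρ) * T₀.acceptProb ρ := by
  rw [← Complex.ofReal_inj, SampleTester.ofReal_acceptProb, SampleTester.ite, copies_add,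
    Matrix.submatrix_mul_equiv]
  have h : ∀ M : Op ((Fin s → Qubits n) × (Fin t → Qubits n)),
      (M.submatrix (Fin.appendEquiv s t).symm (Fin.appendEquiv s t).symm).trace = M.trace :=
    fun M => Equiv.sum_comp (Fin.appendEquiv s t).symm fun p => M p p
  rw [h, Matrix.add_mul, ← Matrix.mul_kronecker_mul, ← Matrix.mul_kronecker_mul, Matrix.trace_add,
    Matrix.trace_kronecker, Matrix.trace_kronecker, T.trace_reject, ← T.ofReal_acceptProb,
    ← T₁.ofReal_acceptProb, ← T₀.ofReal_acceptProb]
  push_cast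
  ring

/-- The tester that always accepts. -/
def SampleTester.always (n s : ℕ) : SampleTester n s where
  accept := 1
  accept_posSemidef := Matrix.PosSemidef.one
  reject_posSemidef := by rw [sub_self]; exact Matrix.PosSemidef.zero

/-- The tester that never accepts. -/
def SampleTester.never (n s : ℕ) : SampleTester n s where
  accept := 0
  accept_posSemidef := Matrix.PosSemidef.zero
  reject_posSemidef := by rw [sub_zero]; exact Matrix.PosSemidef.one

/-- The majority vote of three runs of a tester. -/
noncomputable def SampleTester.majority (T : SampleTester n s) : SampleTester n (s + (s + s)) :=
  T.ite (T.ite (.always n s) T) (T.ite T (.never n s))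

theorem SampleTester.acceptProb_majority (T : SampleTester n s) (ρ : DensityOperator n) :
    T.majority.acceptProb ρ = T.acceptProb ρ ^ 2 * (3 - 2 * T.acceptProb ρ) := by
  have h1 : (SampleTester.always n s).acceptProb ρ = 1 := by
    simp [SampleTester.acceptProb, SampleTester.always, trace_copies]
  have h0 : (SampleTester.never n s).acceptProb ρ = 0 := by
    simp [SampleTester.acceptProb, SampleTester.never]
  simp only [SampleTester.majority, SampleTester.acceptProb_ite, h1, h0]
  ring

/-- At `p = 0.65` and `p = 0.35` the majority probability `p² (3 - 2 p)` is about `0.718` and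
`0.282`, so an error of `1 / 60` is affordable. -/
theorem SampleTester.majority_solves {P : StateTestingProblem n} {T : SampleTester n s}
    (hyes : ∀ ρ ∈ P.yes, 2 / 3 - 1 / 60 ≤ T.acceptProb ρ)
    (hno : ∀ ρ ∈ P.no, T.acceptProb ρ ≤ 1 / 3 + 1 / 60) : T.majority.Solves P := by
  constructor
  · intro ρ hρ
    have h := hyes ρ hρ
    obtain ⟨h0, h1⟩ := T.acceptProb_mem_Icc ρ
    rw [T.acceptProb_majority]
    set p := T.acceptProb ρ
    nlinarith [mul_nonneg (sub_nonneg.2 h) (sub_nonneg.2 h1),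
      mul_nonneg h0 (mul_nonneg (sub_nonneg.2 h) (sub_nonneg.2 h1))]
  · intro ρ hρ
    have h := hno ρ hρ
    obtain ⟨h0, h1⟩ := T.acceptProb_mem_Icc ρ
    rw [T.acceptProb_majority]
    set p := T.acceptProb ρ
    nlinarith [mul_nonneg (sub_nonneg.2 h) h0,
      mul_nonneg (sub_nonneg.2 h1) (mul_nonneg (sub_nonneg.2 h) h0)]

end Testers

/-! ### The lifting theorem -/

/-- `q` queries to a block-encoding of `ρ / 2` can be replaced by `O(q ^ 2)` samples of `ρ`. -/
theorem exists_sampleTester_of_querySolvable {n : ℕ} {P : StateTestingProblem n} {q : ℕ}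
    (h : QuerySolvable P q) :
    ∃ T : SampleTester n ((480 * q) ^ 2 + ((480 * q) ^ 2 + (480 * q) ^ 2)), T.Solves P := by
  -- The ancillas hold the rotation qubit, the flag, and the two `n`-qubit registers of the
  -- purification.
  obtain ⟨A, hA, hsol⟩ := h (2 * n + 2)
  -- This number of copies brings the error `8 q / √(k + 1)` down to `8 / 480 = 1 / 60`; for `q = 0`
  -- there is no error at all.
  obtain ⟨M, hM, hM', hMΨ⟩ := exists_povm_of_queryAlgorithm A ((480 * q) ^ 2)
  obtain ⟨T, hT⟩ := exists_sampleTester hM hM'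
  have hδ : 8 * (A.queries : ℝ) / √(((480 * q) ^ 2 : ℕ) + 1) ≤ 1 / 60 := by
    rw [hA, div_le_iff₀ (by positivity)]
    have h1 : (480 * q : ℝ) ≤ √(((480 * q) ^ 2 : ℕ) + 1) := by
      apply Real.le_sqrt_of_sq_le
      push_cast
      linarith
    linarith
  refine ⟨T.majority, SampleTester.majority_solves (fun ρ hρ => ?_) fun ρ hρ => ?_⟩
  · refine hT ρ (Set.Ici _) (convex_Ici _) isClosed_Ici fun Ψ hΨ => ?_
    obtain ⟨U, hU, hle⟩ := hMΨ ρ Ψ hΨ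
    have h1 := (hsol ρ U hU).1 hρ
    have h2 := (abs_le.1 (hle.trans hδ)).1
    rw [Set.mem_Ici]
    linarith
  · refine hT ρ (Set.Iic _) (convex_Iic _) isClosed_Iic fun Ψ hΨ => ?_
    obtain ⟨U, hU, hle⟩ := hMΨ ρ Ψ hΨ
    have h1 := (hsol ρ U hU).2 hρ
    have h2 := (abs_le.1 (hle.trans hδ)).2
    rw [Set.mem_Iic]
    linarith

theorem sampleComplexity_le_of_querySolvable {n : ℕ} {P : StateTestingProblem n} {q : ℕ}
    (h : QuerySolvable P q) : sampleComplexity P ≤ ((3 * (480 * q) ^ 2 : ℕ) : ℕ∞) := by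
  have h1 : sampleComplexity P ≤
      (((480 * q) ^ 2 + ((480 * q) ^ 2 + (480 * q) ^ 2) : ℕ) : ℕ∞) :=
    iInf₂_le (f := fun (s : ℕ) (_ : ∃ T : SampleTester n s, T.Solves P) => (s : ℕ∞)) _
      (exists_sampleTester_of_querySolvable h)
  refine h1.trans (le_of_eq ?_)
  congr 1
  ring

/-- The infimum in the definition of the query complexity is attained unless it is infinite. -/
theorem queryComplexity_eq_top_or {n : ℕ} (P : StateTestingProblem n) :
    queryComplexity P = ⊤ ∨ ∃ q : ℕ, QuerySolvable P q ∧ queryComplexity P = q := by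
  classical
  by_cases h : ∃ q, QuerySolvable P q
  · refine Or.inr ⟨Nat.find h, Nat.find_spec h, le_antisymm (iInf₂_le _ (Nat.find_spec h)) ?_⟩
    exact le_iInf₂ fun q hq => by exact_mod_cast Nat.find_min' h hq
  · refine Or.inl ?_
    push Not at h
    simp [queryComplexity, h]

end QuantumLifting

theorem theorem3p1 :
    ∃ c : ℝ, 0 < c ∧ ∀ (n : ℕ) (P : QuantumLifting.StateTestingProblem n),
      (∀ s : ℕ, QuantumLifting.sampleComplexity P = s → 2 ≤ s →
        ENNReal.ofReal (c * (Real.sqrt s / Real.log s)) ≤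
          (QuantumLifting.queryComplexity P : ENNReal)) ∧
      (QuantumLifting.sampleComplexity P = ⊤ → QuantumLifting.queryComplexity P = ⊤) := by
  have hlog2 : 0 < Real.log 2 := Real.log_pos (by norm_num)
  -- The `960` comes from `3 * 480 ^ 2 ≤ 960 ^ 2`, and `log 2` compensates for dividing by `log s`,
  -- which is at least `log 2`.
  refine ⟨Real.log 2 / 960, by positivity, fun n P => ⟨fun s hs hs2 => ?_, fun h => ?_⟩⟩
  · rcases QuantumLifting.queryComplexity_eq_top_or P with hQ | ⟨q, hq, hQ⟩
    · rw [hQ]; simp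
    · have h1 := QuantumLifting.sampleComplexity_le_of_querySolvable hq
      rw [hs, Nat.cast_le] at h1
      rw [hQ, ENat.toENNReal_coe, ← ENNReal.ofReal_natCast]
      refine ENNReal.ofReal_le_ofReal ?_
      have h2 : (s : ℝ) ≤ (960 * q) ^ 2 := by
        have h3 : (s : ℝ) ≤ 3 * (480 * q) ^ 2 := by exact_mod_cast h1
        nlinarith [sq_nonneg (q : ℝ)]
      have h4 : √(s : ℝ) ≤ 960 * q := Real.sqrt_le_iff.2 ⟨by positivity, h2⟩
      have h5 : Real.log 2 ≤ Real.log s := Real.log_le_log (by norm_num) (by exact_mod_cast hs2)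
      calc Real.log 2 / 960 * (√s / Real.log s)
          = √s / 960 * (Real.log 2 / Real.log s) := by ring
        _ ≤ √s / 960 * 1 := by
            gcongr
            exact div_le_one_of_le₀ h5 (hlog2.le.trans h5)
        _ ≤ q := by linarith
  · rcases QuantumLifting.queryComplexity_eq_top_or P with hQ | ⟨q, hq, -⟩
    · exact hQ
    · have h1 := QuantumLifting.sampleComplexity_le_of_querySolvable hq
      rw [h, top_le_iff] at h1
      exact absurd h1 (ENat.natCast_ne_top _)
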